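/- **Setting.** Let $X$ and $Y_1,\dots,Y_N$ be real Banach spaces, let $p\ge 2$ and $p^*=p/(p-1)$. Assume that $X$ is uniformly smooth and $p$-convex, i.e. for some $K>0$ its modulus of convexity $\delta_X(\tau)=\inf\{1-\tfrac12\|z+w\|:\|z\|=\|w\|=1,\ \|z-w\|\ge\tau\}$ satisfies $\delta_X(\tau)\ge K\tau^p$ for all $\tau\in(0,2]$. For a Banach space $E$ and an exponent $s>1$ the duality map is $$J_s^{E}(z)=\{z^*\in E^*:\ \langle z^*,z\rangle=\|z\|\,\|z^*\|,\ \|z\|^{s-1}=\|z^*\|\};$$ it is single-valued if $E$ is smooth, in particular for $E=X$ and $E=X^*$. Write $J_p=J_p^X$ and let $$D(z,w)=\tfrac1{p^*}\|z\|^p+\tfrac1p\|w\|^p-\langle J_p(z),w\rangle$$ be the Bregman distance, and $B_\nu(w)=\{z\in X: D(z,w)\le\nu\}$. Let $G_{p^*}$ be the least constant $G$ such that the Bregman distance $D_*$ of $X^*$ (defined in the same way with exponent $p^*$) satisfies $D_*(z^*,w^*)\le\frac{G}{p^*}\|w^*-z^*\|^{p^*}$ for all $z^*,w^*\in X^*$.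 Let $F_i:\mathcal D(F_i)\subset X\to Y_i$ $(i=1,\dots,N)$, $F=(F_1,\dots,F_N)$, $\mathcal D(F)=\bigcap_i\mathcal D(F_i)$, $Y=Y_1\times\dots\times Y_N$, $y=(y_1,\dots,y_N)\in Y$, and let $\mathcal S\subset\mathcal D(F)$ be closed and convex. Let $x_0\in X$, and let $x^\dagger\in\mathcal S$ be the $x_0$-minimum-distance solution, i.e. $F(x^\dagger)=y$ and $D(x_0,x^\dagger)=\inf\{D(x_0,x): x\in\mathcal S,\ F(x)=y\}$. Assume: 1. there is $\nu>0$ with $B_\nu(x^\dagger)\subset\mathcal S$ and $x_0\in B_\nu(x^\dagger)$; 2. each $F_i$ is Fréchet differentiable in $\mathcal S$ with $\|F_i'(x)\|\le L_i$ for all $x\in\mathcal S$; put $L_{\max}=\max_i L_i$; 3. there is $0<\gamma<1$ with $\|F_i(x)-F_i(\tilde x)-F_i'(x)(x-\tilde x)\|\le\gamma\|F_i(x)-F_i(\tilde x)\|$ for all $x,\tilde x\in\mathcal S$ and all $i$; 4. $F:\mathcal D(F)\to Y$ is weak-to-weak continuous, and $\mathrm{Null}(F'(x^\dagger))\subset\mathrm{Null}(F'(x))$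 for all $x\in\mathcal S$; 5. the step-sizes $\mu_k>0$ $(k\ge1)$ satisfy $\sum_{k\ge1}\mu_k=\infty$ and, for some $C>0$, $1-\gamma-L_{\max}^{p^*}\frac{G_{p^*}}{p^*}\mu_k^{p^*-1}\ge C$ for all $k\ge 1$. Let $i_1,i_2,\dots$ be independent random indices, uniformly distributed on $\{1,\dots,N\}$, let $j_i$ be a single-valued selection of the duality map $J_p^{Y_i}$, and let $(x_k)$ be the iterates of stochastic gradient descent for the exact data $y$, started at $x_0$: $$x_{k+1}=J_{p^*}^{X^*}\big(J_p(x_k)-\mu_{k+1}\,g_{k+1}\big),\qquad g_{k+1}=F_{i_{k+1}}'(x_k)^*\,j_{i_{k+1}}\big(F_{i_{k+1}}(x_k)-y_{i_{k+1}}\big),\qquad k\ge 0.$$ **Theorem.** Under these assumptions $$\lim_{k\to\infty}\mathbb E[D(x_k,x^\dagger)]=0,$$ $$\lim_{k\to\infty}\mathbb E[\|x_k-x^\dagger\|^r]=0\quad\text{for every }1\le r\le p,\qquad\text{and}\qquad \lim_{k\to\infty}\mathbb E[\|J_p(x_k)-J_p(x^\dagger)\|_{X^*}^{p^*}]=0,$$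 where all the random variables whose expectations appear are integrable. -/

import Mathlib

open Filter Topology MeasureTheory ProbabilityTheory Set

noncomputable section

/-- The modulus of convexity
`δ_E(τ) = inf {1 - ‖z + w‖ / 2 : ‖z‖ = ‖w‖ = 1, ‖z - w‖ ≥ τ}`, an infimum in the extended reals
(so that it is `+∞` over the empty set, which for `0 < τ ≤ 2` happens only if `E = 0`). -/
def modulusOfConvexity (E : Type*) [NormedAddCommGroup E] [NormedSpace ℝ E] (τ : ℝ) : EReal :=
  ⨅ (z : E) (w : E) (_ : ‖z‖ = 1 ∧ ‖w‖ = 1 ∧ τ ≤ ‖z - w‖), ((1 - ‖z + w‖ / 2 : ℝ) : EReal)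

/-- `E` is `p`-convex: `δ_E(τ) ≥ K τ ^ p` for some `K > 0` and all `τ ∈ (0, 2]`. -/
def IsPConvex (p : ℝ) (E : Type*) [NormedAddCommGroup E] [NormedSpace ℝ E] : Prop :=
  ∃ K : ℝ, 0 < K ∧ ∀ τ ∈ Ioc (0 : ℝ) 2, ((K * τ ^ p : ℝ) : EReal) ≤ modulusOfConvexity E τ

/-- The modulus of smoothness
`ρ_E(τ) = sup {(‖z + τ w‖ + ‖z - τ w‖) / 2 - 1 : ‖z‖ = ‖w‖ = 1}`
(the set is bounded above by `τ` for `τ > 0`). -/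
def modulusOfSmoothness (E : Type*) [NormedAddCommGroup E] [NormedSpace ℝ E] (τ : ℝ) : ℝ :=
  sSup {s : ℝ | ∃ z w : E, ‖z‖ = 1 ∧ ‖w‖ = 1 ∧ s = (‖z + τ • w‖ + ‖z - τ • w‖) / 2 - 1}

/-- `E` is uniformly smooth: `ρ_E(τ) / τ → 0` as `τ ↘ 0`. -/
def IsUniformlySmooth (E : Type*) [NormedAddCommGroup E] [NormedSpace ℝ E] : Prop :=
  Tendsto (fun τ : ℝ => modulusOfSmoothness E τ / τ) (𝓝[>] 0) (𝓝 0)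

section Duality

variable {E : Type*} [NormedAddCommGroup E] [NormedSpace ℝ E]

/-- The (set-valued) duality map with gauge function `t ↦ t ^ (p - 1)`. -/
def dualityMap (p : ℝ) (x : E) : Set (StrongDual ℝ E) :=
  {f | f x = ‖x‖ * ‖f‖ ∧ ‖x‖ ^ (p - 1) = ‖f‖}

theorem dualityMap_nonempty {p : ℝ} (hp : 1 < p) (x : E) : (dualityMap p x).Nonempty := by
  have hp' : p - 1 ≠ 0 := by linarith
  by_cases hx : x = 0
  · exact ⟨0, by simp [dualityMap, hx, Real.zero_rpow hp']⟩
  · obtain ⟨g, hg, hgx⟩ := exists_dual_vector ℝ x (norm_ne_zero_iff.mpr hx)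
    have hpos : 0 ≤ ‖x‖ ^ (p - 1) := Real.rpow_nonneg (norm_nonneg x) _
    refine ⟨(‖x‖ ^ (p - 1)) • g, ?_, ?_⟩
    · rw [norm_smul, hg, Real.norm_of_nonneg hpos]
      simp [hgx, mul_comm]
    · rw [norm_smul, hg, Real.norm_of_nonneg hpos, mul_one]

/-- The duality map as a function. In a smooth space the set `dualityMap p x` has exactly one
element (`1 < p`), and this is that element; in general it is some element of the set. -/
def dualityMapFun (p : ℝ) (x : E) : StrongDual ℝ E :=
  Classical.epsilon fun f => f ∈ dualityMap p x

theorem dualityMapFun_mem {p : ℝ} (hp : 1 < p) (x : E) : dualityMapFun p x ∈ dualityMap p x :=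
  Classical.epsilon_spec (p := fun f => f ∈ dualityMap p x) (dualityMap_nonempty hp x)

/-- The Bregman distance `D(z, w) = ‖z‖ ^ p / p* + ‖w‖ ^ p / p - ⟨J_p(z), w⟩`. -/
def bregman (p : ℝ) (z w : E) : ℝ :=
  ‖z‖ ^ p / p.conjExponent + ‖w‖ ^ p / p - dualityMapFun p z w

/-- The ball of radius `ν` around `x` in the Bregman distance, `{z : D(z, x) ≤ ν}`. -/
def bregmanBall (p : ℝ) (x : E) (ν : ℝ) : Set E :=
  {z | bregman p z x ≤ ν}

end Duality

/-- The constant `G_{p*}` of the space `E`: the least constant `G` for which the Bregman distance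
of the dual space satisfies `D(z*, w*) ≤ (G / p*) ‖w* - z*‖ ^ p*` for all `z*, w*`. -/
def dualSmoothnessConst (p : ℝ) (E : Type*) [NormedAddCommGroup E] [NormedSpace ℝ E] : ℝ :=
  sInf {G : ℝ | 0 < G ∧ ∀ z w : StrongDual ℝ E,
    bregman p.conjExponent z w ≤ G / p.conjExponent * ‖w - z‖ ^ p.conjExponent}

section System

variable {X : Type*} [NormedAddCommGroup X] [NormedSpace ℝ X] {N : ℕ}
  {Y : Fin N → Type*} [∀ i, NormedAddCommGroup (Y i)] [∀ i, NormedSpace ℝ (Y i)]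

/-- `xs` is an `x₀`-minimum-distance solution of `F_i(x) = y_i`, `i = 1, …, N`, in `S`:
it minimizes `D(x₀, ·)` over the solutions that lie in `S`. -/
def IsMinDistanceSolution (p : ℝ) (F : ∀ i, X → Y i) (y : ∀ i, Y i) (S : Set X) (x₀ xs : X) :
    Prop :=
  xs ∈ {x ∈ S | ∀ i, F i x = y i} ∧ IsMinOn (bregman p x₀) {x ∈ S | ∀ i, F i x = y i} xs

/-- Continuity of `F = (F_1, …, F_N)` on `D`, from the weak topology of `X` to the weak topology
of the product of the `Y_i`. -/
def WeakToWeakContinuousOn (F : ∀ i, X → Y i) (D : Set X) : Prop :=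
  ContinuousOn
    (fun x : WeakSpace ℝ X =>
      toWeakSpace ℝ (∀ i, Y i) (fun i => F i ((toWeakSpace ℝ X).symm x)))
    ((toWeakSpace ℝ X).symm ⁻¹' D)

/-- The stochastic update direction `g(x, y, i) = F_i'(x)^* j_i(F_i(x) - y_i)`, where `j_i` is a
selection of the duality map of `Y_i`. The adjoint of `A` is `φ ↦ φ ∘ A`. -/
def sgdDirection (F : ∀ i, X → Y i) (F' : ∀ i, X → X →L[ℝ] Y i) (y : ∀ i, Y i)
    (j : ∀ i, Y i → StrongDual ℝ (Y i)) (x : X) (i : Fin N) : StrongDual ℝ X :=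
  (j i (F i x - y i)).comp (F' i x)

/-- `x` is the sequence of iterates for the index sequence `idx` (`idx (k + 1)` is the index used
in step `k + 1`): `x_0 = x₀` and
`x_{k+1} = J_{p*}^{X*} (J_p(x_k) - μ_{k+1} g(x_k, y, i_{k+1}))`.
The duality map `J_{p*}^{X*}` of the dual space has its values in the bidual, into which `X` is
canonically embedded. -/
def IsSGDSequence (p : ℝ) (F : ∀ i, X → Y i) (F' : ∀ i, X → X →L[ℝ] Y i) (y : ∀ i, Y i)
    (j : ∀ i, Y i → StrongDual ℝ (Y i)) (μ : ℕ → ℝ) (x₀ : X) (idx : ℕ → Fin N) (x : ℕ → X) :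
    Prop :=
  x 0 = x₀ ∧ ∀ k, NormedSpace.inclusionInDoubleDual ℝ X (x (k + 1)) ∈
    dualityMap p.conjExponent
      (dualityMapFun p (x k) - μ (k + 1) • sgdDirection F F' y j (x k) (idx (k + 1)))

end System

end

/-! The convergence is proved path by path and then integrated. Since `X` is `p`-convex, its dual is
smooth of power type `p*`; the cone condition and the step-size bound then make every step, whatever
the index, decrease `D(x_k, x†)` by at least a multiple of `μ_{k+1} ‖F_i(x_k) - y_i‖ ^ p`
(`bregman_step_le`). So every path stays in the Bregman ball. Taking expectations, with `i_{k+1}`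
independent of `x_k`, and telescoping shows that `∑ μ_{k+1} R(x_k)` is finite almost surely, where
`R` is the total residual (`ae_summable_residualPow`).

Fix such a path. As `∑ μ_k = ∞`, `R(x_k)` comes arbitrarily close to `0`, so either it vanishes at
some iterate or there are infinitely many record times `k`, at which `R(x_k) ≤ R(x_l)` for all `l ≤
k`. At a record time the cone condition bounds `⟨J_p(x_k) - J_p(x_m), x_k - x†⟩` by six times a
block of the convergent series, and the three-point identity makes the records a Cauchy sequence.
The limit solves the equations. All updates annihilate `Null(F'(x†))`, so `J_p(limit) - J_p(x₀)`
does too; by optimality of `x†` and strict monotonicity of `J_p` the limit is `x†`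
(`eq_xs_of_orthogonal`). Monotonicity of `D(x_k, x†)` carries convergence from the records to the
whole path (`tendsto_of_summable`).

All quantities are bounded in terms of `D(x₀, x†)`, so dominated convergence gives the three limits.
-/

noncomputable section

/-! ### Scalar power inequalities -/

section PowerInequalities

/-- The power `t ^ (p / 2)` is superadditive and convex, and `a ^ 2 + b ^ 2` is the mean of `(a + b)
^ 2` and `(a - b) ^ 2`. -/
theorem two_mul_rpow_add_two_mul_rpow_le {a b p : ℝ} (hb : 0 ≤ b) (hab : b ≤ a) (hp : 2 ≤ p) :
    2 * a ^ p + 2 * b ^ p ≤ (a + b) ^ p + (a - b) ^ p := by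
  have ha : 0 ≤ a := hb.trans hab
  have hp2 : 1 ≤ p / 2 := by linarith
  have sq (t : ℝ) (ht : 0 ≤ t) : t ^ p = (t ^ 2) ^ (p / 2) := by
    rw [← Real.rpow_natCast, ← Real.rpow_mul ht]
    congr 1
    push_cast
    ring
  have h1 : (a ^ 2) ^ (p / 2) + (b ^ 2) ^ (p / 2) ≤ (a ^ 2 + b ^ 2) ^ (p / 2) := by
    have := NNReal.add_rpow_le_rpow_add (⟨a ^ 2, by positivity⟩) (⟨b ^ 2, by positivity⟩) hp2
    exact_mod_cast this
  have h2 := (convexOn_rpow hp2).2 (show (a + b) ^ 2 ∈ Ici (0 : ℝ) by simp; positivity)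
    (show (a - b) ^ 2 ∈ Ici (0 : ℝ) by simp; positivity)
    (show (0 : ℝ) ≤ 1 / 2 by norm_num) (show (0 : ℝ) ≤ 1 / 2 by norm_num) (by norm_num)
  simp only [smul_eq_mul] at h2
  rw [show 1 / 2 * (a + b) ^ 2 + 1 / 2 * (a - b) ^ 2 = a ^ 2 + b ^ 2 by ring] at h2
  rw [sq a ha, sq b hb, sq (a + b) (by positivity), sq (a - b) (by linarith)]
  linarith

theorem sub_rpow_le {m δ p : ℝ} (hm : 0 < m) (hδ : 0 ≤ δ) (hδm : δ ≤ m) (hp : 1 ≤ p) :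
    (m - δ) ^ p ≤ m ^ p - m ^ (p - 1) * δ := by
  rcases hδm.eq_or_lt with rfl | h
  · rw [sub_self, Real.zero_rpow (by linarith), ← Real.rpow_add_one hm.ne', sub_add_cancel,
      sub_self]
  · have h0 : 0 < m - δ := by linarith
    have e1 : (m - δ) ^ p = (m - δ) ^ (p - 1) * (m - δ) := by
      rw [← Real.rpow_add_one h0.ne', sub_add_cancel]
    have e2 : m ^ p = m ^ (p - 1) * m := by
      rw [← Real.rpow_add_one hm.ne', sub_add_cancel]
    have h1 : (m - δ) ^ (p - 1) ≤ m ^ (p - 1) :=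
      Real.rpow_le_rpow h0.le (by linarith) (by linarith)
    rw [e1, e2]
    nlinarith [mul_le_mul_of_nonneg_right h1 h0.le]

end PowerInequalities

/-! ### From the modulus of convexity to uniform convexity of `‖·‖ ^ p` -/

section PConvex

variable {E : Type*} [NormedAddCommGroup E] [NormedSpace ℝ E] {p : ℝ}

theorem IsPConvex.exists_norm_add_le (h : IsPConvex p E) :
    ∃ K : ℝ, 0 < K ∧ ∀ τ : ℝ, 0 < τ → τ ≤ 2 → ∀ z w : E, ‖z‖ = 1 → ‖w‖ = 1 → τ ≤ ‖z - w‖ →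
      ‖z + w‖ / 2 ≤ 1 - K * τ ^ p := by
  obtain ⟨K, hK, h⟩ := h
  refine ⟨K, hK, fun τ h0 h2 z w hz hw hzw => ?_⟩
  have h1 : ((K * τ ^ p : ℝ) : EReal) ≤ ((1 - ‖z + w‖ / 2 : ℝ) : EReal) :=
    (h τ ⟨h0, h2⟩).trans (iInf_le_of_le z (iInf_le_of_le w (iInf_le _ ⟨hz, hw, hzw⟩)))
  have := EReal.coe_le_coe_iff.1 h1
  linarith

/-- Two regimes. If the gap `1 - ‖y‖` is at least `‖x - y‖ / 4`, the scalar inequality for the norms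
already yields the gain. Otherwise `y` is close to the unit sphere, and the modulus of convexity
applies to `x` and the normalized `y`. The constant is the smaller of the two gains. -/
theorem IsPConvex.exists_midpoint_le_of_norm_eq_one (h : IsPConvex p E) (hp : 2 ≤ p) :
    ∃ c : ℝ, 0 < c ∧ ∀ x y : E, ‖x‖ = 1 → ‖y‖ ≤ 1 →
      c * ‖x - y‖ ^ p + 2 * ‖(1 / 2 : ℝ) • (x + y)‖ ^ p ≤ 1 + ‖y‖ ^ p := by
  obtain ⟨K, hK, hKE⟩ := h.exists_norm_add_le
  refine ⟨min (2 * (1 / 8 : ℝ) ^ p) (2 * ((1 / 2 : ℝ) ^ (p - 1) * (K / 2 * (3 / 4) ^ p))),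
    by positivity, fun x y hx hy => ?_⟩
  set c := min (2 * (1 / 8 : ℝ) ^ p) (2 * ((1 / 2 : ℝ) ^ (p - 1) * (K / 2 * (3 / 4) ^ p)))
  set s := ‖y‖ with hs
  set d := ‖x - y‖ with hd
  have hs0 : 0 ≤ s := norm_nonneg _
  have hd0 : 0 ≤ d := norm_nonneg _
  have hd2 : d ≤ 1 + s := by simpa [hx] using norm_sub_le x y
  have hdp : 0 ≤ d ^ p := by positivity
  have hmid : 2 * ((1 + s) / 2) ^ p + 2 * ((1 - s) / 2) ^ p ≤ 1 + s ^ p := by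
    have := two_mul_rpow_add_two_mul_rpow_le (a := (1 + s) / 2) (b := (1 - s) / 2) (p := p)
      (by linarith) (by linarith) hp
    rw [show (1 + s) / 2 + (1 - s) / 2 = 1 by ring, show (1 + s) / 2 - (1 - s) / 2 = s by ring,
      Real.one_rpow] at this
    exact this
  rcases le_or_gt (d / 4) (1 - s) with hc | hc
  · have h1 : c * d ^ p ≤ 2 * ((1 - s) / 2) ^ p := by
      calc c * d ^ p ≤ 2 * (1 / 8 : ℝ) ^ p * d ^ p := by gcongr; exact min_le_left _ _
        _ = 2 * (1 / 8 * d) ^ p := by rw [Real.mul_rpow (by norm_num) hd0]; ring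
        _ ≤ _ := by gcongr; linarith
    have h2 : ‖(1 / 2 : ℝ) • (x + y)‖ ≤ (1 + s) / 2 := by
      rw [norm_smul, Real.norm_of_nonneg (by norm_num)]
      have := norm_add_le x y
      rw [hx] at this
      linarith
    have h3 : ‖(1 / 2 : ℝ) • (x + y)‖ ^ p ≤ ((1 + s) / 2) ^ p := by gcongr
    linarith
  · have hs2 : 1 / 2 < s := by linarith
    have hdpos : 0 < d := by linarith
    set y' := s⁻¹ • y with hy'
    have hyy : y = s • y' := by rw [hy', smul_inv_smul₀ (by linarith)]
    have hy1 : ‖y'‖ = 1 := by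
      rw [hy', norm_smul, norm_inv, Real.norm_of_nonneg hs0, inv_mul_cancel₀ (by linarith)]
    have hyd : ‖y' - y‖ = 1 - s := by
      rw [hyy, show y' - s • y' = (1 - s) • y' by rw [sub_smul, one_smul], norm_smul, hy1,
        Real.norm_of_nonneg (by linarith), mul_one]
    have hxy : 3 / 4 * d ≤ ‖x - y'‖ := by
      have := norm_sub_le_norm_sub_add_norm_sub x y' y
      linarith
    have hτ := hKE (3 / 4 * d) (by linarith) (by linarith) x y' hx hy1 hxy
    set δ := K / 2 * (3 / 4 * d) ^ p with hδ
    have hδ0 : 0 ≤ δ := by positivity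
    have hle : ‖(1 / 2 : ℝ) • (x + y)‖ ≤ (1 + s) / 2 - δ := by
      -- Only the part `s • x` of `x` is paired with `y = s • y'`. This gains `2 * s * δ`, which is
      -- at least `δ` because `s > 1 / 2`.
      have e : (1 / 2 : ℝ) • (x + y) = (s / 2) • (x + y') + ((1 - s) / 2) • x := by
        rw [hyy]
        module
      rw [e]
      refine (norm_add_le _ _).trans ?_
      rw [norm_smul, norm_smul, hx, Real.norm_of_nonneg (by linarith),
        Real.norm_of_nonneg (by linarith)]
      have h2 : δ ≤ s * (2 * δ) := by nlinarith
      have h3 : K * (3 / 4 * d) ^ p = 2 * δ := by rw [hδ]; ring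
      rw [h3] at hτ
      nlinarith [mul_le_mul_of_nonneg_left hτ hs0]
    have h0 : 0 ≤ (1 + s) / 2 - δ := (norm_nonneg _).trans hle
    have h1 : ‖(1 / 2 : ℝ) • (x + y)‖ ^ p ≤ ((1 + s) / 2 - δ) ^ p := by gcongr
    have h2 := sub_rpow_le (m := (1 + s) / 2) (δ := δ) (p := p) (by linarith) hδ0 (by linarith)
      (by linarith)
    have h3 : (1 / 2 : ℝ) ^ (p - 1) ≤ ((1 + s) / 2) ^ (p - 1) :=
      Real.rpow_le_rpow (by norm_num) (by linarith) (by linarith)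
    have h4 : c * d ^ p ≤ 2 * ((1 / 2 : ℝ) ^ (p - 1) * δ) := by
      calc c * d ^ p ≤ 2 * ((1 / 2 : ℝ) ^ (p - 1) * (K / 2 * (3 / 4) ^ p)) * d ^ p := by
            gcongr; exact min_le_right _ _
        _ = _ := by rw [hδ, Real.mul_rpow (by norm_num) hd0]; ring
    have h5 : 0 ≤ ((1 - s) / 2) ^ p := Real.rpow_nonneg (by linarith) _
    nlinarith [mul_le_mul_of_nonneg_right h3 hδ0]

/-- In a `p`-convex space the function `‖·‖ ^ p` is uniformly convex of power type `p`. -/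
theorem IsPConvex.exists_midpoint_le (h : IsPConvex p E) (hp : 2 ≤ p) :
    ∃ c : ℝ, 0 < c ∧ ∀ x y : E,
      c * ‖x - y‖ ^ p + 2 * ‖(1 / 2 : ℝ) • (x + y)‖ ^ p ≤ ‖x‖ ^ p + ‖y‖ ^ p := by
  obtain ⟨c, hc, H⟩ := h.exists_midpoint_le_of_norm_eq_one hp
  refine ⟨c, hc, ?_⟩
  -- Both sides are symmetric and homogeneous of degree `p`, so one may divide by the larger norm.
  have key : ∀ x y : E, ‖y‖ ≤ ‖x‖ →
      c * ‖x - y‖ ^ p + 2 * ‖(1 / 2 : ℝ) • (x + y)‖ ^ p ≤ ‖x‖ ^ p + ‖y‖ ^ p := by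
    intro x y hxy
    rcases eq_or_ne x 0 with rfl | hx
    · have : y = 0 := by simpa using hxy
      simp [this, Real.zero_rpow (by linarith : p ≠ 0)]
    · have hx0 : 0 < ‖x‖ := norm_pos_iff.2 hx
      have hn (v : E) : ‖v‖ = ‖x‖ * ‖‖x‖⁻¹ • v‖ := by
        rw [norm_smul, norm_inv, norm_norm, mul_inv_cancel_left₀ hx0.ne']
      have hn' (v : E) : ‖v‖ ^ p = ‖x‖ ^ p * ‖‖x‖⁻¹ • v‖ ^ p := by
        conv_lhs => rw [hn v]
        rw [Real.mul_rpow (norm_nonneg _) (norm_nonneg _)]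
      have h1 := H (‖x‖⁻¹ • x) (‖x‖⁻¹ • y)
        (by rw [norm_smul, norm_inv, norm_norm, inv_mul_cancel₀ hx0.ne'])
        (by rw [norm_smul, norm_inv, norm_norm]; exact inv_mul_le_one_of_le₀ hxy hx0.le)
      rw [hn' (x - y), hn' ((1 / 2 : ℝ) • (x + y)), hn' y, smul_comm, smul_add, smul_sub]
      have h2 := mul_le_mul_of_nonneg_left h1 (Real.rpow_nonneg hx0.le p)
      linarith
  intro x y
  rcases le_total ‖y‖ ‖x‖ with hxy | hxy
  · exact key x y hxy
  · have := key y x hxy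
    rw [norm_sub_rev, add_comm y x] at this
    linarith

end PConvex

/-! ### Duality maps and Bregman distances -/

section DualityMap

variable {E : Type*} [NormedAddCommGroup E] [NormedSpace ℝ E] {p q : ℝ}

theorem dualityMap_apply_self (hp : 1 < p) {z : E} {φ : StrongDual ℝ E} (h : φ ∈ dualityMap p z) :
    φ z = ‖z‖ ^ p := by
  rw [h.1, ← h.2]
  rcases eq_or_ne z 0 with rfl | hz
  · simp [Real.zero_rpow (by linarith : p ≠ 0)]
  · rw [mul_comm, ← Real.rpow_add_one (norm_ne_zero_iff.2 hz), sub_add_cancel]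

theorem dualityMap_norm_rpow (hpq : p.HolderConjugate q) {z : E} {φ : StrongDual ℝ E}
    (h : φ ∈ dualityMap p z) : ‖φ‖ ^ q = ‖z‖ ^ p := by
  rw [← h.2, ← Real.rpow_mul (norm_nonneg _), hpq.sub_one_mul_conj]

/-- An element of the duality map is a subgradient of `‖·‖ ^ p / p`. -/
theorem dualityMap_subgradient (hp : 1 < p) {z : E} {φ : StrongDual ℝ E}
    (h : φ ∈ dualityMap p z) (w : E) : ‖z‖ ^ p / p + φ (w - z) ≤ ‖w‖ ^ p / p := by
  have hpq := Real.HolderConjugate.conjExponent hp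
  have h1 : φ w ≤ ‖w‖ ^ p / p + ‖φ‖ ^ p.conjExponent / p.conjExponent :=
    ((le_abs_self _).trans (φ.le_opNorm w)).trans
      ((mul_comm ‖φ‖ ‖w‖).le.trans (Real.young_inequality_of_nonneg (norm_nonneg _)
        (norm_nonneg _) hpq))
  rw [dualityMap_norm_rpow hpq h, div_eq_mul_inv _ p.conjExponent, ← hpq.one_sub_inv] at h1
  rw [map_sub, dualityMap_apply_self hp h, div_eq_mul_inv _ p]
  linarith

/-- The canonical embedding inverts the duality map. -/
theorem inclusionInDoubleDual_mem_dualityMap_iff (hpq : p.HolderConjugate q) {z : E}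
    {φ : StrongDual ℝ E} :
    NormedSpace.inclusionInDoubleDual ℝ E z ∈ dualityMap q φ ↔ φ ∈ dualityMap p z := by
  have hn : ‖NormedSpace.inclusionInDoubleDual ℝ E z‖ = ‖z‖ :=
    (NormedSpace.inclusionInDoubleDualLi ℝ (E := E)).norm_map z
  have e : (p - 1) * (q - 1) = 1 := by
    have := hpq.mul_eq_add
    linarith
  simp only [dualityMap, mem_ofPred_eq, hn, NormedSpace.dual_def]
  refine and_congr ⟨fun h => h.trans (mul_comm _ _), fun h => h.trans (mul_comm _ _)⟩
    ⟨fun h => ?_, fun h => ?_⟩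
  · rw [← h, ← Real.rpow_mul (norm_nonneg _), mul_comm, e, Real.rpow_one]
  · rw [← h, ← Real.rpow_mul (norm_nonneg _), e, Real.rpow_one]

/-- In this form the Bregman distance is the gap between `‖·‖ ^ p / p` and its tangent at `z`. -/
theorem bregman_eq (hp : 1 < p) (z w : E) :
    bregman p z w = ‖w‖ ^ p / p - ‖z‖ ^ p / p - dualityMapFun p z (w - z) := by
  have hpq := Real.HolderConjugate.conjExponent hp
  rw [bregman, map_sub, dualityMap_apply_self hp (dualityMapFun_mem hp z),
    div_eq_mul_inv _ p.conjExponent, ← hpq.one_sub_inv, div_eq_mul_inv _ p]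
  ring

theorem bregman_nonneg (hp : 1 < p) (z w : E) : 0 ≤ bregman p z w := by
  have := dualityMap_subgradient hp (dualityMapFun_mem hp z) w
  rw [bregman_eq hp]
  linarith

theorem bregman_self (hp : 1 < p) (z : E) : bregman p z z = 0 := by
  simp [bregman_eq hp]

theorem bregman_three_point (hp : 1 < p) (z x w : E) :
    bregman p z x = bregman p z w - bregman p x w +
      (dualityMapFun p x - dualityMapFun p z) (x - w) := by
  simp only [bregman_eq hp, map_sub, sub_apply]
  ring

/-- The symmetrized distance `D(z, w) + D(w, z)` equals `⟨J_p(z) - J_p(w), z - w⟩`. -/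
theorem bregman_le_norm_mul_norm (hp : 1 < p) (z w : E) :
    bregman p z w ≤ ‖dualityMapFun p z - dualityMapFun p w‖ * ‖z - w‖ := by
  have h := bregman_three_point hp z w z
  rw [bregman_self hp] at h
  have h1 := bregman_nonneg hp w z
  have h2 := ContinuousLinearMap.le_opNorm (dualityMapFun p w - dualityMapFun p z) (w - z)
  rw [norm_sub_rev, norm_sub_rev w z] at h2
  have h3 := (le_abs_self _).trans h2
  linarith

/-- In a `p`-convex space `‖·‖ ^ p / p` lies above its tangents by a multiple of `‖w - z‖ ^ p`. -/
theorem IsPConvex.exists_subgradient_le (h : IsPConvex p E) (hp : 2 ≤ p) :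
    ∃ c : ℝ, 0 < c ∧ ∀ (z w : E), ∀ φ ∈ dualityMap p z,
      ‖z‖ ^ p / p + φ (w - z) + c * ‖z - w‖ ^ p ≤ ‖w‖ ^ p / p := by
  obtain ⟨c, hc, H⟩ := h.exists_midpoint_le hp
  have hp0 : 0 < p := by linarith
  refine ⟨c / p, by positivity, fun z w φ hφ => ?_⟩
  -- The tangent inequality is tested at the midpoint; doubling it restores the full slope and
  -- leaves the convexity gain.
  have h1 := dualityMap_subgradient (by linarith) hφ ((1 / 2 : ℝ) • (z + w))
  rw [show (1 / 2 : ℝ) • (z + w) - z = (1 / 2 : ℝ) • (w - z) by module, map_smul,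
    smul_eq_mul] at h1
  have h2 := div_le_div_of_nonneg_right (H z w) hp0.le
  rw [add_div, add_div, mul_div_assoc 2] at h2
  have : c / p * ‖z - w‖ ^ p = c * ‖z - w‖ ^ p / p := by ring
  linarith

theorem IsPConvex.exists_le_bregman (h : IsPConvex p E) (hp : 2 ≤ p) :
    ∃ c : ℝ, 0 < c ∧ ∀ z w : E, c * ‖z - w‖ ^ p ≤ bregman p z w := by
  obtain ⟨c, hc, H⟩ := h.exists_subgradient_le hp
  refine ⟨c, hc, fun z w => ?_⟩
  have := H z w _ (dualityMapFun_mem (by linarith) z)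
  rw [bregman_eq (by linarith)]
  linarith

/-- Strict monotonicity: adding the tangent inequalities at `z` and at `w` bounds `c * ‖z - w‖ ^ p`
by the pairing. -/
theorem IsPConvex.eq_of_dualityMap (h : IsPConvex p E) (hp : 2 ≤ p) {z w : E}
    {φ ψ : StrongDual ℝ E} (hφ : φ ∈ dualityMap p z) (hψ : ψ ∈ dualityMap p w)
    (hzw : (φ - ψ) (z - w) = 0) : z = w := by
  obtain ⟨c, hc, H⟩ := h.exists_subgradient_le hp
  have h1 := H z w φ hφ
  have h2 := dualityMap_subgradient (by linarith) hψ z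
  simp only [map_sub, sub_apply] at h1 h2 hzw
  have h3 : c * ‖z - w‖ ^ p ≤ 0 := by linarith
  have h4 : ‖z - w‖ ^ p ≤ 0 := by nlinarith
  have h5 : ‖z - w‖ ^ p = 0 := le_antisymm h4 (by positivity)
  rw [Real.rpow_eq_zero (norm_nonneg _) (by linarith), norm_eq_zero, sub_eq_zero] at h5
  exact h5

end DualityMap

/-! ### Smoothness of `X`, surjectivity of the duality map, smoothness of the dual -/

section Smooth

variable {E : Type*} [NormedAddCommGroup E] [NormedSpace ℝ E] {p q : ℝ}

theorem le_modulusOfSmoothness {τ : ℝ} (hτ : 0 ≤ τ) {z w : E} (hz : ‖z‖ = 1) (hw : ‖w‖ = 1) :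
    (‖z + τ • w‖ + ‖z - τ • w‖) / 2 - 1 ≤ modulusOfSmoothness E τ := by
  refine le_csSup ⟨τ, ?_⟩ ⟨z, w, hz, hw, rfl⟩
  rintro s ⟨z, w, hz, hw, rfl⟩
  have h1 := norm_add_le z (τ • w)
  have h2 := norm_sub_le z (τ • w)
  rw [norm_smul, Real.norm_of_nonneg hτ, hz, hw] at h1 h2
  linarith

/-- As `ψ` is a subgradient, the remainder is nonnegative. The inequality `ψ (z - v) ≤ ‖z - v‖`
bounds it above by `‖z + v‖ + ‖z - v‖ - 2 * ‖z‖`, which the modulus of smoothness makes `o(‖v‖)`. -/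
theorem IsUniformlySmooth.hasFDerivAt_norm (h : IsUniformlySmooth E) {z : E} (hz : z ≠ 0)
    {ψ : StrongDual ℝ E} (hψ : ‖ψ‖ = 1) (hψz : ψ z = ‖z‖) :
    HasFDerivAt (fun x : E => ‖x‖) ψ z := by
  have hz0 : 0 < ‖z‖ := norm_pos_iff.2 hz
  rw [hasFDerivAt_iff_isLittleO_nhds_zero, Asymptotics.isLittleO_iff]
  intro ε hε
  have h1 : ∀ᶠ τ in 𝓝[>] (0 : ℝ), modulusOfSmoothness E τ / τ < ε / 2 :=
    h.eventually (gt_mem_nhds (by positivity))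
  obtain ⟨δ, hδ, h1⟩ := mem_nhdsGT_iff_exists_Ioo_subset.1 h1
  have hδ : 0 < δ := hδ
  have hle (v : E) : ψ v ≤ ‖v‖ := by
    have := (le_abs_self _).trans (ψ.le_opNorm v)
    rwa [hψ, one_mul] at this
  filter_upwards [Metric.ball_mem_nhds (0 : E) (mul_pos hδ hz0)] with v hv
  rw [mem_ball_zero_iff] at hv
  have hlow : 0 ≤ ‖z + v‖ - ‖z‖ - ψ v := by
    have := hle (z + v)
    rw [map_add, hψz] at this
    linarith
  rw [Real.norm_of_nonneg hlow]
  rcases eq_or_ne v 0 with rfl | hv0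
  · simp
  have hvp : 0 < ‖v‖ := norm_pos_iff.2 hv0
  have hτ0 : 0 < ‖v‖ / ‖z‖ := by positivity
  have h2 : modulusOfSmoothness E (‖v‖ / ‖z‖) / (‖v‖ / ‖z‖) < ε / 2 :=
    h1 ⟨hτ0, (div_lt_iff₀ hz0).2 hv⟩
  rw [div_lt_iff₀ hτ0] at h2
  have h3 := le_modulusOfSmoothness hτ0.le (z := ‖z‖⁻¹ • z) (w := ‖v‖⁻¹ • v)
    (by rw [norm_smul, norm_inv, norm_norm, inv_mul_cancel₀ hz0.ne'])
    (by rw [norm_smul, norm_inv, norm_norm, inv_mul_cancel₀ hvp.ne'])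
  have e : (‖v‖ / ‖z‖) • ‖v‖⁻¹ • v = ‖z‖⁻¹ • v := by
    rw [smul_smul]
    congr 1
    field_simp
  rw [e, ← smul_add, ← smul_sub, norm_smul, norm_smul, norm_inv, norm_norm] at h3
  have h4 := h3.trans h2.le
  have h5 : ‖z + v‖ + ‖z - v‖ - 2 * ‖z‖ ≤ ε * ‖v‖ := by
    have := mul_le_mul_of_nonneg_left h4 (by positivity : 0 ≤ 2 * ‖z‖)
    field_simp at this
    linarith
  have h6 := hle (z - v)
  rw [map_sub, hψz] at h6
  linarith

theorem IsUniformlySmooth.hasFDerivAt_rpow (h : IsUniformlySmooth E) (hp : 1 < p) {z : E}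
    {φ : StrongDual ℝ E} (hφ : φ ∈ dualityMap p z) :
    HasFDerivAt (fun x : E => ‖x‖ ^ p / p) φ z := by
  have hp0 : 0 < p := by linarith
  rcases eq_or_ne z 0 with rfl | hz
  · have hφ0 : φ = 0 := by
      rw [← norm_eq_zero, ← hφ.2, norm_zero, Real.zero_rpow (by linarith)]
    rw [hφ0, hasFDerivAt_iff_isLittleO_nhds_zero, Asymptotics.isLittleO_iff]
    intro ε hε
    have hc : Tendsto (fun v : E => ‖v‖ ^ (p - 1)) (𝓝 0) (𝓝 0) := by
      have : Continuous fun v : E => ‖v‖ ^ (p - 1) :=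
        continuous_norm.rpow_const fun _ => Or.inr (by linarith)
      simpa [Real.zero_rpow (by linarith : p - 1 ≠ 0)] using this.tendsto 0
    filter_upwards [hc.eventually (gt_mem_nhds hε)] with v hv
    have hv2 : ‖v‖ ^ p ≤ ε * ‖v‖ := by
      rcases eq_or_ne v 0 with rfl | hv0
      · simp [Real.zero_rpow hp0.ne']
      · calc ‖v‖ ^ p = ‖v‖ ^ (p - 1) * ‖v‖ := by
              rw [← Real.rpow_add_one (norm_ne_zero_iff.2 hv0), sub_add_cancel]
          _ ≤ ε * ‖v‖ := by gcongr
    have hv3 : 0 ≤ ‖v‖ ^ p := by positivity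
    simp only [zero_add, norm_zero, Real.zero_rpow hp0.ne', zero_div, sub_zero,
      zero_apply]
    rw [Real.norm_of_nonneg (by positivity)]
    exact (div_le_self hv3 hp.le).trans hv2
  · have hz0 : 0 < ‖z‖ := norm_pos_iff.2 hz
    have hzp : 0 < ‖z‖ ^ (p - 1) := by positivity
    have h1 : HasFDerivAt (fun x : E => ‖x‖) ((‖z‖ ^ (p - 1))⁻¹ • φ) z := by
      refine h.hasFDerivAt_norm hz ?_ ?_
      · rw [norm_smul, ← hφ.2, norm_inv, Real.norm_of_nonneg hzp.le, inv_mul_cancel₀ hzp.ne']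
      · rw [smul_apply, hφ.1, ← hφ.2, smul_eq_mul]
        field_simp
    have h2 := (h1.rpow_const (p := p) (Or.inl hz0.ne')).mul_const p⁻¹
    have e : p⁻¹ • (p * ‖z‖ ^ (p - 1)) • (‖z‖ ^ (p - 1))⁻¹ • φ = φ := by
      rw [smul_smul, smul_smul, show p⁻¹ * (p * ‖z‖ ^ (p - 1)) * (‖z‖ ^ (p - 1))⁻¹ = 1 by
        field_simp, one_smul]
    rw [e] at h2
    exact h2

/-- In a uniformly smooth space the duality map is single-valued. -/
theorem IsUniformlySmooth.eq_dualityMapFun (h : IsUniformlySmooth E) (hp : 1 < p) {z : E}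
    {φ : StrongDual ℝ E} (hφ : φ ∈ dualityMap p z) : φ = dualityMapFun p z :=
  (h.hasFDerivAt_rpow hp hφ).unique (h.hasFDerivAt_rpow hp (dualityMapFun_mem hp z))

/-- In a uniformly smooth space the duality map is norm-to-norm continuous. -/
theorem IsUniformlySmooth.continuous_dualityMapFun (h : IsUniformlySmooth E) (hp : 1 < p) :
    Continuous (dualityMapFun p : E → StrongDual ℝ E) := by
  rw [continuous_iff_continuousAt]
  intro z
  rw [Metric.continuousAt_iff]
  intro ε hε
  have hd := h.hasFDerivAt_rpow hp (dualityMapFun_mem hp z)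
  rw [hasFDerivAt_iff_isLittleO_nhds_zero, Asymptotics.isLittleO_iff] at hd
  obtain ⟨δ, hδ, hd⟩ := Metric.eventually_nhds_iff.1 (hd (by positivity : 0 < ε / 4))
  simp only [dist_zero_right] at hd
  refine ⟨δ / 3, by positivity, fun {x} hx => ?_⟩
  rw [dist_eq_norm] at hx ⊢
  refine lt_of_le_of_lt (ContinuousLinearMap.opNorm_le_of_unit_norm (C := ε / 2) (by positivity)
    ?_) (by linarith)
  have key : ∀ v : E, ‖v‖ = 1 → (dualityMapFun p x - dualityMapFun p z) v ≤ ε / 2 := by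
    intro v hv
    -- The tangents at `x` and at `z` sandwich `⟨J x - J z, (δ / 3) • v⟩` below the Fréchet
    -- remainder at `z`; the radius `δ / 3` keeps the total displacement from `z` below `δ`.
    have h1 := dualityMap_subgradient hp (dualityMapFun_mem hp x) (x + (δ / 3) • v)
    have h2 := dualityMap_subgradient hp (dualityMapFun_mem hp z) x
    have hn : ‖x - z + (δ / 3) • v‖ ≤ 2 * δ / 3 := by
      refine (norm_add_le _ _).trans ?_
      rw [norm_smul, hv, Real.norm_of_nonneg (by positivity)]
      linarith
    have h3 := (le_abs_self _).trans (hd (y := x - z + (δ / 3) • v) (by linarith))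
    rw [show z + (x - z + (δ / 3) • v) = x + (δ / 3) • v by abel] at h3
    have h4 : ε / 4 * ‖x - z + (δ / 3) • v‖ ≤ ε / 4 * (2 * δ / 3) := by gcongr
    simp only [add_sub_cancel_left, map_add, map_sub, map_smul, smul_eq_mul, sub_apply]
      at h1 h2 h3 ⊢
    have h5 : δ / 3 * (dualityMapFun p x v - dualityMapFun p z v) ≤ δ / 3 * (ε / 2) := by
      linarith
    exact le_of_mul_le_mul_left h5 (by positivity)
  intro v hv
  rw [Real.norm_eq_abs, abs_le]
  have h1 := key v hv
  have h2 := key (-v) (by rwa [norm_neg])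
  rw [map_neg] at h2
  exact ⟨by linarith, h1⟩

theorem cauchySeq_of_norm_rpow_le {V : Type*} [NormedAddCommGroup V] {u : ℕ → V} {c : ℝ} (hc : 0 < c) (hp : 0 < p)
    (h : ∀ ε : ℝ, 0 < ε → ∃ n₀, ∀ n ≥ n₀, c * ‖u n₀ - u n‖ ^ p ≤ ε) : CauchySeq u := by
  rw [Metric.cauchySeq_iff']
  intro ε hε
  obtain ⟨n₀, h⟩ := h (c * (ε / 2) ^ p) (by positivity)
  refine ⟨n₀, fun n hn => ?_⟩
  have h1 := le_of_mul_le_mul_left (h n hn) hc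
  rw [Real.rpow_le_rpow_iff (norm_nonneg _) (by positivity) hp] at h1
  rw [dist_eq_norm, norm_sub_rev]
  linarith

/-- In a complete, `p`-convex and uniformly smooth space the duality map is surjective. -/
theorem IsPConvex.exists_mem_dualityMap [CompleteSpace E] (h : IsPConvex p E)
    (hs : IsUniformlySmooth E) (hp : 2 ≤ p) (ξ : StrongDual ℝ E) :
    ∃ z : E, ξ ∈ dualityMap p z := by
  have hp0 : 0 < p := by linarith
  have hp1 : 1 < p := by linarith
  have hpq := Real.HolderConjugate.conjExponent hp1
  obtain ⟨c, hc, H⟩ := h.exists_midpoint_le hp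
  -- A preimage of `ξ` is a minimizer of `g`, where the derivative `J_p(z) - ξ` vanishes. Uniform
  -- convexity makes a minimizing sequence Cauchy, so completeness suffices for its existence.
  set g : E → ℝ := fun x => ‖x‖ ^ p / p - ξ x with hg
  have hgc : Continuous g :=
    ((continuous_norm.rpow_const fun _ => Or.inr hp0.le).div_const p).sub ξ.continuous
  have hbdd : BddBelow (range g) := by
    refine ⟨-(‖ξ‖ ^ p.conjExponent / p.conjExponent), ?_⟩
    rintro _ ⟨x, rfl⟩
    have h1 : ξ x ≤ ‖x‖ ^ p / p + ‖ξ‖ ^ p.conjExponent / p.conjExponent :=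
      ((le_abs_self _).trans (ξ.le_opNorm x)).trans
        ((mul_comm ‖ξ‖ ‖x‖).le.trans (Real.young_inequality_of_nonneg (norm_nonneg _)
          (norm_nonneg _) hpq))
    simp only [hg]
    linarith
  set m := ⨅ x, g x with hm
  have hle (x : E) : m ≤ g x := ciInf_le hbdd x
  have hmid (x y : E) : c / p * ‖x - y‖ ^ p ≤ g x + g y - 2 * m := by
    have h1 := div_le_div_of_nonneg_right (H x y) hp0.le
    have h2 := hle ((1 / 2 : ℝ) • (x + y))
    simp only [hg, map_smul, map_add, smul_eq_mul] at h2 ⊢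
    rw [add_div, add_div, mul_div_assoc 2] at h1
    have : c / p * ‖x - y‖ ^ p = c * ‖x - y‖ ^ p / p := by ring
    linarith
  have hex (n : ℕ) : ∃ x, g x < m + 1 / (n + 1 : ℝ) :=
    exists_lt_of_ciInf_lt (lt_add_of_pos_right _ Nat.one_div_pos_of_nat)
  choose u hu using hex
  have hlim : Tendsto (fun n => g (u n)) atTop (𝓝 m) := by
    refine tendsto_of_tendsto_of_tendsto_of_le_of_le tendsto_const_nhds ?_
      (fun n => hle (u n)) (fun n => (hu n).le)
    simpa using tendsto_const_nhds.add (tendsto_one_div_add_atTop_nhds_zero_nat (𝕜 := ℝ))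
  have hcau : CauchySeq u := by
    refine cauchySeq_of_norm_rpow_le (div_pos hc hp0) hp0 fun ε hε => ?_
    obtain ⟨n₀, hn₀⟩ := eventually_atTop.1
      (hlim.eventually (gt_mem_nhds (by linarith : m < m + ε / 2)))
    refine ⟨n₀, fun n hn => (hmid _ _).trans ?_⟩
    linarith [hn₀ n₀ le_rfl, hn₀ n hn]
  obtain ⟨z, hz⟩ := cauchySeq_tendsto_of_complete hcau
  have hgz : g z = m := tendsto_nhds_unique ((hgc.tendsto z).comp hz) hlim
  have hmin : IsLocalMin g z := Eventually.of_forall fun x => hgz ▸ hle x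
  have hd := (hs.hasFDerivAt_rpow hp1 (dualityMapFun_mem hp1 z)).sub ξ.hasFDerivAt
  have h0 := hmin.hasFDerivAt_eq_zero hd
  exact ⟨z, sub_eq_zero.1 h0 ▸ dualityMapFun_mem hp1 z⟩

/-- Replace `v` by `t • v`, divide by `t` and let `t ↘ 0`; then use `-v`. -/
theorem eq_zero_of_apply_le_rpow {T : StrongDual ℝ E} {c : ℝ} (hq : 1 < q)
    (h : ∀ v, T v ≤ c * ‖v‖ ^ q) : T = 0 := by
  have key (v : E) : T v ≤ 0 := by
    have h1 : Tendsto (fun t : ℝ => c * ‖v‖ ^ q * t ^ (q - 1)) (𝓝[>] 0) (𝓝 0) := by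
      have : Tendsto (fun t : ℝ => t ^ (q - 1)) (𝓝 0) (𝓝 0) := by
        simpa [Real.zero_rpow (by linarith : q - 1 ≠ 0)] using
          (Real.continuous_rpow_const (by linarith : 0 ≤ q - 1)).tendsto 0
      simpa using (this.mono_left nhdsWithin_le_nhds).const_mul (c * ‖v‖ ^ q)
    refine ge_of_tendsto h1 ?_
    filter_upwards [self_mem_nhdsWithin] with t ht
    have ht : 0 < t := ht
    have h2 := h (t • v)
    rw [map_smul, smul_eq_mul, norm_smul, Real.norm_of_nonneg ht.le,
      Real.mul_rpow ht.le (norm_nonneg _)] at h2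
    refine le_of_mul_le_mul_left (h2.trans_eq ?_) ht
    rw [show t ^ q = t ^ (q - 1) * t by rw [← Real.rpow_add_one ht.ne', sub_add_cancel]]
    ring
  ext v
  have h1 := key v
  have h2 := key (-v)
  rw [map_neg] at h2
  exact le_antisymm h1 (by simpa using h2)

/-- The dual of a `p`-convex space is smooth of power type `p*`. -/
theorem IsPConvex.exists_dual_smooth [CompleteSpace E] (h : IsPConvex p E)
    (hs : IsUniformlySmooth E) (hp : 2 ≤ p) (hpq : p.HolderConjugate q) :
    ∃ c : ℝ, 0 < c ∧ ∀ (z : E), ∀ φ ∈ dualityMap p z, ∀ ψ : StrongDual ℝ E,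
      ‖ψ‖ ^ q / q ≤ ‖φ‖ ^ q / q + (ψ - φ) z + c * ‖ψ - φ‖ ^ q := by
  have hp0 : 0 < p := by linarith
  have hp1 : 1 < p := by linarith
  have hq0 : 0 < q := hpq.symm.pos
  obtain ⟨c, hc, H⟩ := h.exists_subgradient_le hp
  -- Chosen so that Young's inequality with weight `t` yields exactly `c * ‖z - w‖ ^ p`, the term
  -- absorbed by `p`-convexity.
  set t : ℝ := (c * p) ^ p⁻¹ with ht
  have ht0 : 0 < t := by positivity
  have htp : t ^ p = c * p := by rw [ht, Real.rpow_inv_rpow (by positivity) hp0.ne']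
  refine ⟨(t⁻¹) ^ q / q, by positivity, fun z φ hφ ψ => ?_⟩
  obtain ⟨w, hψ⟩ := h.exists_mem_dualityMap hs hp ψ
  have h1 := H z w φ hφ
  have h2 : (ψ - φ) (w - z) ≤ (t⁻¹) ^ q / q * ‖ψ - φ‖ ^ q + c * ‖z - w‖ ^ p := by
    calc (ψ - φ) (w - z) ≤ ‖ψ - φ‖ * ‖w - z‖ := (le_abs_self _).trans ((ψ - φ).le_opNorm _)
      _ = (t⁻¹ * ‖ψ - φ‖) * (t * ‖z - w‖) := by
        rw [norm_sub_rev w z]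
        field_simp
      _ ≤ (t⁻¹ * ‖ψ - φ‖) ^ q / q + (t * ‖z - w‖) ^ p / p :=
        Real.young_inequality_of_nonneg (by positivity) (by positivity) hpq.symm
      _ = _ := by
        rw [Real.mul_rpow (by positivity) (norm_nonneg _),
          Real.mul_rpow (by positivity) (norm_nonneg _), htp]
        field_simp
  rw [dualityMap_norm_rpow hpq hφ, dualityMap_norm_rpow hpq hψ, div_eq_mul_inv _ q,
    div_eq_mul_inv (‖z‖ ^ p) q, ← hpq.one_sub_inv]
  have e1 := dualityMap_apply_self hp1 hφ
  have e2 := dualityMap_apply_self hp1 hψ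
  simp only [map_sub, sub_apply] at h1 h2 ⊢
  rw [div_eq_mul_inv] at h1
  rw [div_eq_mul_inv] at h1
  linarith

/-- Comparing any subgradient of `‖·‖ ^ q / q` at `φ` with the smooth upper bound of slope `z` shows
that their difference is superlinearly small, hence zero. This makes the Bregman distance of the
dual explicit. -/
theorem IsPConvex.dualityMapFun_dual [CompleteSpace E] (h : IsPConvex p E)
    (hs : IsUniformlySmooth E) (hp : 2 ≤ p) (hpq : p.HolderConjugate q) {z : E}
    {φ : StrongDual ℝ E} (hφ : φ ∈ dualityMap p z) :
    dualityMapFun q φ = NormedSpace.inclusionInDoubleDual ℝ E z := by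
  obtain ⟨c, hc, H⟩ := h.exists_dual_smooth hs hp hpq
  rw [← sub_eq_zero]
  refine eq_zero_of_apply_le_rpow (c := c) hpq.symm.lt fun v => ?_
  have h1 := H z φ hφ (φ + v)
  have h2 := dualityMap_subgradient hpq.symm.lt (dualityMapFun_mem hpq.symm.lt φ) (φ + v)
  rw [add_sub_cancel_left] at h1 h2
  rw [sub_apply, NormedSpace.dual_def]
  linarith

theorem dualSmoothnessConst_nonneg : 0 ≤ dualSmoothnessConst p E :=
  Real.sInf_nonneg fun _ h => h.1.le

/-- The constant `dualSmoothnessConst p E` is attained. -/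
theorem IsPConvex.dual_smooth [CompleteSpace E] (h : IsPConvex p E)
    (hs : IsUniformlySmooth E) (hp : 2 ≤ p) {z : E} {φ : StrongDual ℝ E}
    (hφ : φ ∈ dualityMap p z) (ψ : StrongDual ℝ E) :
    ‖ψ‖ ^ p.conjExponent / p.conjExponent ≤
      ‖φ‖ ^ p.conjExponent / p.conjExponent + (ψ - φ) z +
        dualSmoothnessConst p E / p.conjExponent * ‖ψ - φ‖ ^ p.conjExponent := by
  have hpq := Real.HolderConjugate.conjExponent (by linarith : 1 < p)
  set q := p.conjExponent with hq
  have hq0 : 0 < q := hpq.symm.pos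
  have hbreg {z : E} {φ : StrongDual ℝ E} (hφ : φ ∈ dualityMap p z) (ψ : StrongDual ℝ E) :
      bregman q φ ψ = ‖ψ‖ ^ q / q - ‖φ‖ ^ q / q - (ψ - φ) z := by
    rw [bregman_eq hpq.symm.lt, h.dualityMapFun_dual hs hp hpq hφ, NormedSpace.dual_def]
  -- Nonemptiness matters: the real infimum of the empty set would be `0`.
  have hne : {G : ℝ | 0 < G ∧ ∀ z w : StrongDual ℝ E,
      bregman q z w ≤ G / q * ‖w - z‖ ^ q}.Nonempty := by
    obtain ⟨c, hc, H⟩ := h.exists_dual_smooth hs hp hpq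
    refine ⟨c * q, by positivity, fun φ ψ => ?_⟩
    obtain ⟨z, hφ⟩ := h.exists_mem_dualityMap hs hp φ
    rw [hbreg hφ, mul_div_cancel_right₀ _ hq0.ne']
    linarith [H z φ hφ ψ]
  have hle : bregman q φ ψ ≤ dualSmoothnessConst p E / q * ‖ψ - φ‖ ^ q := by
    refine le_of_forall_pos_lt_add fun ε hε => ?_
    set a := ‖ψ - φ‖ ^ q / q with ha
    have ha0 : 0 ≤ a := by positivity
    obtain ⟨G, hG, hlt⟩ := exists_lt_of_csInf_lt hne
      (show dualSmoothnessConst p E < dualSmoothnessConst p E + ε / (a + 1) from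
        lt_add_of_pos_right _ (by positivity))
    calc bregman q φ ψ ≤ G / q * ‖ψ - φ‖ ^ q := hG.2 φ ψ
      _ = G * a := by rw [ha]; ring
      _ ≤ (dualSmoothnessConst p E + ε / (a + 1)) * a := by gcongr
      _ = dualSmoothnessConst p E * a + ε * (a / (a + 1)) := by ring
      _ < dualSmoothnessConst p E * a + ε * 1 := by
        gcongr
        rw [div_lt_one (by positivity)]
        linarith
      _ = _ := by rw [ha]; ring
  rw [hbreg hφ] at hle
  linarith

end Smooth

/-! ### Deterministic analysis of a single path -/

section Path

variable {X : Type*} [NormedAddCommGroup X] [NormedSpace ℝ X] {N : ℕ}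
  {Y : Fin N → Type*} [∀ i, NormedAddCommGroup (Y i)] [∀ i, NormedSpace ℝ (Y i)]
  {p : ℝ} {F : ∀ i, X → Y i} {F' : ∀ i, X → X →L[ℝ] Y i} {y : ∀ i, Y i}
  {j : ∀ i, Y i → StrongDual ℝ (Y i)} {S : Set X} {Λ γ : ℝ} {μ : ℕ → ℝ} {C : ℝ} {x₀ xs : X}

/-- The sum `∑ ‖F_i(x) - y_i‖ ^ p` of the powers of the residuals. -/
def residualPow (p : ℝ) (F : ∀ i, X → Y i) (y : ∀ i, Y i) (x : X) : ℝ :=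
  ∑ i, ‖F i x - y i‖ ^ p

/-- The deterministic assumptions on the inverse problem and the step-sizes. -/
structure SGDSetting (p : ℝ) (F : ∀ i, X → Y i) (F' : ∀ i, X → X →L[ℝ] Y i) (y : ∀ i, Y i)
    (j : ∀ i, Y i → StrongDual ℝ (Y i)) (S : Set X) (Λ γ : ℝ) (μ : ℕ → ℝ) (C : ℝ) (x₀ xs : X) :
    Prop where
  two_le : 2 ≤ p
  pconvex : IsPConvex p X
  smooth : IsUniformlySmooth X
  closed : IsClosed S
  norm_deriv_le : ∀ i, ∀ x ∈ S, ‖F' i x‖ ≤ Λ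
  lt_one : γ < 1
  cone : ∀ i, ∀ x ∈ S, ∀ x' ∈ S, ‖F i x - F i x' - F' i x (x - x')‖ ≤ γ * ‖F i x - F i x'‖
  sol : IsMinDistanceSolution p F y S x₀ xs
  ball : {z | bregman p z xs ≤ bregman p x₀ xs} ⊆ S
  mem_nhds : S ∈ 𝓝 xs
  ker : ∀ x ∈ S, ∀ h : X, (∀ i, F' i xs h = 0) → ∀ i, F' i x h = 0
  selection : ∀ i, ∀ v, j i v ∈ dualityMap p v
  step_pos : ∀ k, 0 < μ (k + 1)
  const_pos : 0 < C
  step_le : ∀ k, C ≤ 1 - γ - Λ ^ p.conjExponent *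
      (dualSmoothnessConst p X / p.conjExponent) * μ (k + 1) ^ (p.conjExponent - 1)
  step_sum : Tendsto (fun n => ∑ k ∈ Finset.range n, μ (k + 1)) atTop atTop

namespace SGDSetting

variable (A : SGDSetting p F F' y j S Λ γ μ C x₀ xs)
include A

theorem one_lt : 1 < p := by linarith [A.two_le]

theorem holder : p.HolderConjugate p.conjExponent := Real.HolderConjugate.conjExponent A.one_lt

theorem xs_mem : xs ∈ S := A.sol.1.1

theorem map_xs (i : Fin N) : F i xs = y i := A.sol.1.2 i

/-- The cone condition gives the factor `1 + γ`, rounded up to `2`. -/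
theorem norm_deriv_apply_le (i : Fin N) {x x' : X} (hx : x ∈ S) (hx' : x' ∈ S) :
    ‖F' i x (x - x')‖ ≤ 2 * ‖F i x - F i x'‖ := by
  have h1 := A.cone i x hx x' hx'
  have h2 := norm_sub_norm_le (F' i x (x - x')) (F i x - F i x')
  rw [norm_sub_rev (F' i x (x - x'))] at h2
  nlinarith [A.lt_one, norm_nonneg (F i x - F i x')]

theorem norm_map_sub_le (i : Fin N) {x x' : X} (hx : x ∈ S) (hx' : x' ∈ S) :
    (1 - γ) * ‖F i x - F i x'‖ ≤ ‖F' i x (x - x')‖ := by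
  have h1 := A.cone i x hx x' hx'
  have h2 := norm_sub_norm_le (F i x - F i x') (F' i x (x - x'))
  linarith

theorem map_eq_of_deriv_eq_zero (i : Fin N) {x x' : X} (hx : x ∈ S) (hx' : x' ∈ S)
    (h : F' i x (x - x') = 0) : F i x' = F i x := by
  have h1 := A.norm_map_sub_le i hx hx'
  rw [h, norm_zero] at h1
  have h2 : ‖F i x - F i x'‖ ≤ 0 := by
    by_contra hlt
    nlinarith [A.lt_one]
  exact (sub_eq_zero.1 (norm_le_zero_iff.1 h2)).symm

/-- On `S` the cone condition and the derivative bound make `F i` Lipschitz with constant `Λ / (1 -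
γ)`. -/
theorem continuousOn_map (i : Fin N) : ContinuousOn (F i) S := by
  have hγ : 0 < 1 - γ := by linarith [A.lt_one]
  refine (LipschitzOnWith.of_dist_le_mul (K := (Λ / (1 - γ)).toNNReal) ?_).continuousOn
  intro x hx x' hx'
  have h0 : 0 ≤ Λ := (norm_nonneg _).trans (A.norm_deriv_le i x hx)
  rw [Real.coe_toNNReal _ (by positivity), dist_eq_norm, dist_eq_norm]
  have h1 := (A.norm_map_sub_le i hx hx').trans ((F' i x).le_opNorm _)
  have h2 : ‖F' i x‖ * ‖x - x'‖ ≤ Λ * ‖x - x'‖ := by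
    gcongr
    exact A.norm_deriv_le i x hx
  rw [div_mul_eq_mul_div, le_div_iff₀ hγ]
  linarith

/-- One step of the method decreases the Bregman distance to the solution. -/
theorem bregman_step_le [CompleteSpace X] {x x' : X} (hx : x ∈ S) (i : Fin N) (k : ℕ)
    (h : dualityMapFun p x - μ (k + 1) • sgdDirection F F' y j x i ∈ dualityMap p x') :
    bregman p x' xs + C * (μ (k + 1) * ‖F i x - y i‖ ^ p) ≤ bregman p x xs := by
  have hpq := A.holder
  have hstep := A.step_le k
  have hm := A.step_pos k
  set m := μ (k + 1)
  set q := p.conjExponent with hq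
  have hq0 : 0 < q := hpq.symm.pos
  set g := sgdDirection F F' y j x i with hg
  set a := ‖F i x - y i‖ with ha
  have hsel := A.selection i (F i x - y i)
  have hjv := dualityMap_apply_self A.one_lt hsel
  have hjn := dualityMap_norm_rpow hpq hsel
  set φ := j i (F i x - y i) with hφ
  have hap : a * ‖φ‖ = a ^ p := by rw [← hjv, hsel.1]
  have hdesc : (1 - γ) * a ^ p ≤ g (x - xs) := by
    have h1 := A.cone i x hx xs A.xs_mem
    rw [A.map_xs] at h1
    have h2 : φ (F i x - y i - F' i x (x - xs)) ≤ ‖φ‖ * (γ * a) :=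
      (le_abs_self _).trans ((φ.le_opNorm _).trans (by gcongr))
    have h3 : g (x - xs) = φ (F' i x (x - xs)) := rfl
    have h4 : ‖φ‖ * (γ * a) = γ * a ^ p := by rw [← hap]; ring
    rw [map_sub, hjv, ← ha, h4] at h2
    rw [h3]
    linarith
  have hΛ0 : 0 ≤ Λ := (norm_nonneg _).trans (A.norm_deriv_le i x hx)
  have hgn : ‖g‖ ^ q ≤ Λ ^ q * a ^ p := by
    rw [← hjn, ← Real.mul_rpow hΛ0 (norm_nonneg _)]
    refine Real.rpow_le_rpow (norm_nonneg _) ?_ hq0.le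
    refine (ContinuousLinearMap.opNorm_comp_le _ _).trans ?_
    rw [mul_comm]
    gcongr
    exact A.norm_deriv_le i x hx
  have hJ := A.smooth.eq_dualityMapFun A.one_lt h
  have hn := dualityMap_norm_rpow hpq h
  have hn' := dualityMap_norm_rpow hpq (dualityMapFun_mem A.one_lt x)
  -- Dual smoothness at `J_p(x)` with increment `-m • g`. The descent term and the error term both
  -- carry the factor `m * a ^ p`, and its coefficient is what the step-size condition bounds below
  -- by `C`.
  have hmain := A.pconvex.dual_smooth A.smooth A.two_le (dualityMapFun_mem A.one_lt x)
    (dualityMapFun p x - m • g)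
  rw [hn, hn', sub_sub_cancel_left, norm_neg, norm_smul, Real.norm_of_nonneg hm.le,
    Real.mul_rpow hm.le (norm_nonneg _)] at hmain
  have hmq : m ^ q = m ^ (q - 1) * m := by
    rw [← Real.rpow_add_one hm.ne', sub_add_cancel]
  have hG : 0 ≤ dualSmoothnessConst p X / q :=
    div_nonneg dualSmoothnessConst_nonneg hq0.le
  have hlast : dualSmoothnessConst p X / q * (m ^ q * ‖g‖ ^ q) ≤
      dualSmoothnessConst p X / q * (m ^ q * (Λ ^ q * a ^ p)) := by gcongr
  rw [bregman, bregman, ← hJ, ← hq]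
  simp only [neg_apply, sub_apply, smul_apply, smul_eq_mul, map_sub] at hmain hdesc ⊢
  have hap0 : 0 ≤ m * a ^ p := by positivity
  have h5 := mul_le_mul_of_nonneg_right hstep hap0
  rw [hmq] at hlast hmain
  have h6 := mul_le_mul_of_nonneg_left hdesc hm.le
  linarith

/-- First-order optimality of the minimum-distance solution. -/
theorem optimality (h : X) (hh : ∀ i, F' i xs h = 0) :
    (dualityMapFun p xs - dualityMapFun p x₀) h = 0 := by
  have hline : HasDerivAt (fun t : ℝ => xs + t • h) h 0 := by
    simpa using ((hasDerivAt_id (0 : ℝ)).smul_const h).const_add xs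
  have hf : HasFDerivAt (fun x : X => ‖x‖ ^ p / p) (dualityMapFun p xs) (xs + (0 : ℝ) • h) := by
    simpa using A.smooth.hasFDerivAt_rpow A.one_lt (dualityMapFun_mem A.one_lt xs)
  have hd := (hf.comp_hasDerivAt (0 : ℝ) hline).sub
    ((dualityMapFun p x₀).hasFDerivAt.comp_hasDerivAt (0 : ℝ) hline)
  refine IsLocalMin.hasDerivAt_eq_zero ?_ hd
  have hc : Tendsto (fun t : ℝ => xs + t • h) (𝓝 0) (𝓝 xs) := by
    simpa using hline.continuousAt.tendsto
  -- By the cone condition `xs + t • h` still solves the system for small `t`, so `D(x₀, ·)` has a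
  -- local minimum along this line at `t = 0`.
  filter_upwards [hc A.mem_nhds] with t ht
  have hsol : xs + t • h ∈ {x ∈ S | ∀ i, F i x = y i} := by
    refine ⟨ht, fun i => ?_⟩
    rw [A.map_eq_of_deriv_eq_zero i A.xs_mem ht (by simp [hh i]), A.map_xs]
  have h1 : bregman p x₀ xs ≤ bregman p x₀ (xs + t • h) := A.sol.2 hsol
  rw [bregman, bregman] at h1
  simp only [Pi.sub_apply, Function.comp_apply, zero_smul, add_zero]
  linarith

/-- The difference `x - xs` lies in `Null(F'(xs))`, which both `J_p(x) - J_p(x₀)` and `J_p(xs) -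
J_p(x₀)` annihilate; strict monotonicity concludes. -/
theorem eq_xs_of_orthogonal {x : X} (hx : x ∈ S) (hxy : ∀ i, F i x = y i)
    (h : ∀ v, (∀ i, F' i xs v = 0) → (dualityMapFun p x - dualityMapFun p x₀) v = 0) :
    x = xs := by
  have hv : ∀ i, F' i xs (x - xs) = 0 := by
    intro i
    have h1 := A.norm_deriv_apply_le i A.xs_mem hx
    rw [hxy, A.map_xs, sub_self, norm_zero, mul_zero] at h1
    rw [← neg_sub, map_neg, norm_le_zero_iff.1 h1, neg_zero]
  refine A.pconvex.eq_of_dualityMap A.two_le (dualityMapFun_mem A.one_lt x)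
    (dualityMapFun_mem A.one_lt xs) ?_
  have h1 := h _ hv
  have h2 := A.optimality _ hv
  simp only [sub_apply] at h1 h2 ⊢
  linarith

theorem exists_residual_lt {x : ℕ → X}
    (hsum : Summable fun k => μ (k + 1) * residualPow p F y (x k)) {ε : ℝ} (hε : 0 < ε) :
    ∃ k, residualPow p F y (x k) < ε := by
  by_contra! h
  have h1 : Summable fun k => μ (k + 1) := by
    refine Summable.of_nonneg_of_le (fun k => (A.step_pos k).le) (fun k => ?_)
      (hsum.mul_left ε⁻¹)
    rw [inv_mul_eq_div, le_div_iff₀ hε]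
    exact mul_le_mul_of_nonneg_left (h k) (A.step_pos k).le
  exact not_tendsto_atTop_of_tendsto_nhds h1.hasSum.tendsto_sum_nat A.step_sum

/-- The first index whose residual drops below the positive minimum over `0, …, n` is a record, and
it lies beyond `n`. -/
theorem frequently_residual_record {x : ℕ → X}
    (hsum : Summable fun k => μ (k + 1) * residualPow p F y (x k))
    (hpos : ∀ k, 0 < residualPow p F y (x k)) :
    ∃ᶠ k in atTop, ∀ l ≤ k, residualPow p F y (x k) ≤ residualPow p F y (x l) := by
  classical
  rw [frequently_atTop]
  intro n
  obtain ⟨l₀, hl₀, hmin⟩ := Finset.exists_min_image (Finset.range (n + 1))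
    (fun k => residualPow p F y (x k)) ⟨0, by simp⟩
  have hex := A.exists_residual_lt hsum (hpos l₀)
  refine ⟨Nat.find hex, ?_, fun l hl => ?_⟩
  · by_contra! hlt
    exact absurd (Nat.find_spec hex) (not_lt.2 (hmin _ (Finset.mem_range.2 (by omega))))
  · rcases hl.eq_or_lt with rfl | hl
    · exact le_rfl
    · exact (Nat.find_spec hex).le.trans (not_lt.1 (Nat.find_min hex hl))

variable {idx : ℕ → Fin N} {x : ℕ → X} (hx : IsSGDSequence p F F' y j μ x₀ idx x)
include hx

theorem mem_dualityMap (k : ℕ) :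
    dualityMapFun p (x k) - μ (k + 1) • sgdDirection F F' y j (x k) (idx (k + 1)) ∈
      dualityMap p (x (k + 1)) :=
  (inclusionInDoubleDual_mem_dualityMap_iff A.holder).1 (hx.2 k)

theorem dualityMapFun_succ (k : ℕ) :
    dualityMapFun p (x (k + 1)) =
      dualityMapFun p (x k) - μ (k + 1) • sgdDirection F F' y j (x k) (idx (k + 1)) :=
  (A.smooth.eq_dualityMapFun A.one_lt (A.mem_dualityMap hx k)).symm

theorem bregman_le_and_mem [CompleteSpace X] (k : ℕ) :
    bregman p (x k) xs ≤ bregman p x₀ xs ∧ x k ∈ S := by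
  suffices h : bregman p (x k) xs ≤ bregman p x₀ xs from ⟨h, A.ball h⟩
  induction k with
  | zero => rw [hx.1]
  | succ k ih =>
    have h1 := A.bregman_step_le (A.ball ih) _ k (A.mem_dualityMap hx k)
    have h2 : 0 ≤ C * (μ (k + 1) * ‖F (idx (k + 1)) (x k) - y (idx (k + 1))‖ ^ p) :=
      mul_nonneg A.const_pos.le (mul_nonneg (A.step_pos k).le (by positivity))
    linarith

theorem bregman_succ_le [CompleteSpace X] (k : ℕ) :
    bregman p (x (k + 1)) xs + C * (μ (k + 1) * ‖F (idx (k + 1)) (x k) - y (idx (k + 1))‖ ^ p) ≤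
      bregman p (x k) xs :=
  A.bregman_step_le (A.bregman_le_and_mem hx k).2 _ k (A.mem_dualityMap hx k)

theorem antitone_bregman [CompleteSpace X] : Antitone fun k => bregman p (x k) xs := by
  refine antitone_nat_of_succ_le fun k => ?_
  have h1 := A.bregman_succ_le hx k
  have h2 : 0 ≤ C * (μ (k + 1) * ‖F (idx (k + 1)) (x k) - y (idx (k + 1))‖ ^ p) :=
    mul_nonneg A.const_pos.le (mul_nonneg (A.step_pos k).le (by positivity))
  linarith

/-- Each update lies in the range of some `F_i'(x_k)^*`, so it annihilates `Null(F'(x_k))`, which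
contains `Null(F'(xs))`. -/
theorem dualityMapFun_sub_orthogonal [CompleteSpace X] (k : ℕ) (v : X)
    (hv : ∀ i, F' i xs v = 0) : (dualityMapFun p (x k) - dualityMapFun p x₀) v = 0 := by
  induction k with
  | zero => simp [hx.1]
  | succ k ih =>
    have h1 : sgdDirection F F' y j (x k) (idx (k + 1)) v = 0 := by
      simp [sgdDirection, A.ker _ (A.bregman_le_and_mem hx k).2 v hv]
    rw [A.dualityMapFun_succ hx]
    simp only [sub_apply, smul_apply, h1, smul_zero, sub_zero] at ih ⊢
    exact ih

/-- Splitting `x k - xs` at `x l` gives `6 = 2 + 2 * 2` by the cone condition. Comparing total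
residuals controls every component at both points by the same `ρ`, whichever index is drawn. -/
theorem sgdDirection_apply_le [CompleteSpace X] {k l : ℕ}
    (hkl : residualPow p F y (x k) ≤ residualPow p F y (x l)) (i : Fin N) :
    |sgdDirection F F' y j (x l) i (x k - xs)| ≤ 6 * residualPow p F y (x l) := by
  have hp0 : 0 < p := by linarith [A.two_le]
  have hk := (A.bregman_le_and_mem hx k).2
  have hl := (A.bregman_le_and_mem hx l).2
  have hR (z : X) : ‖F i z - y i‖ ^ p ≤ residualPow p F y z :=
    Finset.single_le_sum (f := fun i => ‖F i z - y i‖ ^ p)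
      (fun i _ => by positivity) (Finset.mem_univ i)
  set R := residualPow p F y (x l) with hRdef
  have hR0 : 0 ≤ R := le_trans (by positivity) (hR (x l))
  set ρ := R ^ p⁻¹ with hρ
  have hρ0 : 0 ≤ ρ := by positivity
  have hρp : ρ ^ p = R := Real.rpow_inv_rpow hR0 hp0.ne'
  have ha : ‖F i (x l) - y i‖ ≤ ρ := by
    rw [← Real.rpow_le_rpow_iff (norm_nonneg _) hρ0 hp0, hρp]
    exact hR _
  have hb : ‖F i (x k) - y i‖ ≤ ρ := by
    rw [← Real.rpow_le_rpow_iff (norm_nonneg _) hρ0 hp0, hρp]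
    exact (hR _).trans hkl
  have h1 : ‖F' i (x l) (x k - xs)‖ ≤ 6 * ρ := by
    have e : F' i (x l) (x k - xs) = F' i (x l) (x l - xs) - F' i (x l) (x l - x k) := by
      rw [← map_sub]
      congr 1
      abel
    have h2 := A.norm_deriv_apply_le i hl A.xs_mem
    have h3 := A.norm_deriv_apply_le i hl hk
    rw [A.map_xs] at h2
    have h4 : ‖F i (x l) - F i (x k)‖ ≤ ρ + ρ := by
      refine (norm_sub_le_norm_sub_add_norm_sub _ (y i) _).trans ?_
      rw [norm_sub_rev (y i)]
      exact add_le_add ha hb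
    rw [e]
    refine (norm_sub_le _ _).trans ?_
    linarith
  have h2 : ‖j i (F i (x l) - y i)‖ ≤ ρ ^ (p - 1) := by
    rw [← (A.selection i _).2]
    exact Real.rpow_le_rpow (norm_nonneg _) ha (by linarith [A.two_le])
  have h3 : ρ ^ (p - 1) * ρ = R := by
    rw [← hρp]
    rcases hρ0.eq_or_lt with h | h
    · rw [← h, Real.zero_rpow hp0.ne', mul_zero]
    · rw [← Real.rpow_add_one h.ne', sub_add_cancel]
  calc |sgdDirection F F' y j (x l) i (x k - xs)|
      ≤ ‖j i (F i (x l) - y i)‖ * ‖F' i (x l) (x k - xs)‖ :=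
        (j i (F i (x l) - y i)).le_opNorm (F' i (x l) (x k - xs))
    _ ≤ ρ ^ (p - 1) * (6 * ρ) := by gcongr
    _ = 6 * R := by rw [← h3]; ring

theorem dualityMapFun_sub_apply_le [CompleteSpace X] {m k : ℕ} (hmk : m ≤ k)
    (hk : ∀ l ≤ k, residualPow p F y (x k) ≤ residualPow p F y (x l)) :
    (dualityMapFun p (x k) - dualityMapFun p (x m)) (x k - xs) ≤
      6 * (∑ l ∈ Finset.range k, μ (l + 1) * residualPow p F y (x l) -
        ∑ l ∈ Finset.range m, μ (l + 1) * residualPow p F y (x l)) := by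
  -- The induction moves only the upper end `n`; the test vector `x k - xs` stays fixed, since the
  -- record property concerns `k`.
  have key : ∀ n, n ≤ k → m ≤ n →
      (dualityMapFun p (x n) - dualityMapFun p (x m)) (x k - xs) ≤
      6 * (∑ l ∈ Finset.range n, μ (l + 1) * residualPow p F y (x l) -
        ∑ l ∈ Finset.range m, μ (l + 1) * residualPow p F y (x l)) := by
    intro n hnk hmn
    induction n, hmn using Nat.le_induction with
    | base => simp
    | succ n hmn ih =>
      have h1 := ih (by omega)
      have h2 := A.sgdDirection_apply_le hx (hk n (by omega)) (idx (n + 1))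
      have h3 := mul_le_mul_of_nonneg_left ((neg_le_abs _).trans h2) (A.step_pos n).le
      rw [A.dualityMapFun_succ hx, Finset.sum_range_succ]
      simp only [sub_apply, smul_apply, smul_eq_mul] at h1 h3 ⊢
      linarith
  exact key k le_rfl hmk

/-- Convergence of a single path along which the weighted residuals are summable. -/
theorem tendsto_of_summable [CompleteSpace X]
    (hsum : Summable fun k => μ (k + 1) * residualPow p F y (x k)) :
    Tendsto (fun k => bregman p (x k) xs) atTop (𝓝 0) := by
  have hp0 : 0 < p := by linarith [A.two_le]
  have hanti := A.antitone_bregman hx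
  have hmem (k : ℕ) : x k ∈ S := (A.bregman_le_and_mem hx k).2
  have hRi (i : Fin N) (z : X) : ‖F i z - y i‖ ^ p ≤ residualPow p F y z :=
    Finset.single_le_sum (f := fun i => ‖F i z - y i‖ ^ p)
      (fun i _ => by positivity) (Finset.mem_univ i)
  have hR0 (z : X) : 0 ≤ residualPow p F y z := Finset.sum_nonneg fun i _ => by positivity
  suffices h : ∀ ε > 0, ∃ k, bregman p (x k) xs < ε by
    rw [Metric.tendsto_atTop]
    intro ε hε
    obtain ⟨k, hk⟩ := h ε hε
    refine ⟨k, fun n hn => ?_⟩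
    rw [Real.dist_0_eq_abs, abs_of_nonneg (bregman_nonneg A.one_lt _ _)]
    exact (hanti hn).trans_lt hk
  intro ε hε
  -- Records beyond every index are only available while the residual stays positive; an iterate
  -- with zero residual is already `xs`.
  by_cases hpos : ∀ k, 0 < residualPow p F y (x k)
  swap
  · push Not at hpos
    obtain ⟨k, hk⟩ := hpos
    refine ⟨k, ?_⟩
    have hxk : x k = xs := by
      refine A.eq_xs_of_orthogonal (hmem k) (fun i => ?_) (A.dualityMapFun_sub_orthogonal hx k)
      have h1 : ‖F i (x k) - y i‖ ^ p = 0 :=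
        le_antisymm ((hRi i _).trans hk) (by positivity)
      rw [Real.rpow_eq_zero (norm_nonneg _) hp0.ne', norm_eq_zero] at h1
      exact sub_eq_zero.1 h1
    rwa [hxk, bregman_self A.one_lt]
  obtain ⟨κ, hκ, hrec⟩ := extraction_of_frequently_atTop
    (A.frequently_residual_record hsum hpos)
  have hres : Tendsto (fun n => residualPow p F y (x (κ n))) atTop (𝓝 0) := by
    rw [Metric.tendsto_atTop]
    intro η hη
    obtain ⟨k, hk⟩ := A.exists_residual_lt hsum hη
    refine ⟨k, fun n hn => ?_⟩
    rw [Real.dist_0_eq_abs, abs_of_nonneg (hR0 _)]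
    exact (hrec n k (hn.trans (hκ.le_apply))).trans_lt hk
  obtain ⟨c, hc, hbreg⟩ := A.pconvex.exists_le_bregman A.two_le
  obtain ⟨d, hd⟩ : ∃ d, Tendsto (fun k => bregman p (x k) xs) atTop (𝓝 d) :=
    ⟨_, tendsto_atTop_ciInf hanti ⟨0, by rintro _ ⟨k, rfl⟩; exact bregman_nonneg A.one_lt _ _⟩⟩
  -- By the three-point identity, increments of this convergent sequence dominate the Bregman
  -- distance between two record iterates.
  have hb := (hd.sub (hsum.hasSum.tendsto_sum_nat.const_mul 6)).comp hκ.tendsto_atTop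
  have hcau : CauchySeq fun n => x (κ n) := by
    refine cauchySeq_of_norm_rpow_le hc hp0 fun η hη => ?_
    obtain ⟨n₀, hn₀⟩ := Metric.cauchySeq_iff'.1 hb.cauchySeq η hη
    refine ⟨n₀, fun n hn => (hbreg _ _).trans ?_⟩
    have h1 := A.dualityMapFun_sub_apply_le hx (hκ.monotone hn) (hrec n)
    have h2 := (neg_le_abs _).trans_lt (hn₀ n hn)
    simp only [Function.comp_apply] at h2
    rw [bregman_three_point A.one_lt _ _ xs]
    linarith
  obtain ⟨z, hz⟩ := cauchySeq_tendsto_of_complete hcau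
  have hzS : z ∈ S := A.closed.mem_of_tendsto hz (Eventually.of_forall fun n => hmem _)
  have hJc := A.smooth.continuous_dualityMapFun A.one_lt
  have hJ : Tendsto (fun n => dualityMapFun p (x (κ n))) atTop (𝓝 (dualityMapFun p z)) :=
    (hJc.tendsto z).comp hz
  have hzy (i : Fin N) : F i z = y i := by
    have h1 : Tendsto (fun n => F i (x (κ n))) atTop (𝓝 (F i z)) :=
      (A.continuousOn_map i z hzS).tendsto.comp
        (tendsto_nhdsWithin_iff.2 ⟨hz, Eventually.of_forall fun n => hmem _⟩)
    have h2 : Tendsto (fun n => ‖F i (x (κ n)) - y i‖ ^ p) atTop (𝓝 (‖F i z - y i‖ ^ p)) :=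
      (h1.sub_const _).norm.rpow_const (Or.inr hp0.le)
    have h3 : ‖F i z - y i‖ ^ p ≤ 0 := le_of_tendsto_of_tendsto' h2 hres fun n => hRi i _
    have h4 := le_antisymm h3 (by positivity)
    rw [Real.rpow_eq_zero (norm_nonneg _) hp0.ne', norm_eq_zero] at h4
    exact sub_eq_zero.1 h4
  have hzx : z = xs := by
    refine A.eq_xs_of_orthogonal hzS hzy fun v hv => ?_
    have h1 : Tendsto (fun n => (dualityMapFun p (x (κ n)) - dualityMapFun p x₀) v) atTop
        (𝓝 ((dualityMapFun p z - dualityMapFun p x₀) v)) :=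
      ((ContinuousLinearMap.apply ℝ ℝ v).continuous.tendsto _).comp (hJ.sub_const _)
    refine tendsto_nhds_unique h1 ?_
    simp only [A.dualityMapFun_sub_orthogonal hx _ v hv]
    exact tendsto_const_nhds
  rw [hzx] at hz hJ
  have hlim : Tendsto (fun n => ‖dualityMapFun p (x (κ n)) - dualityMapFun p xs‖ *
      ‖x (κ n) - xs‖) atTop (𝓝 0) := by
    simpa using (hJ.sub_const (dualityMapFun p xs)).norm.mul (hz.sub_const xs).norm
  obtain ⟨n, hn⟩ := (hlim.eventually (gt_mem_nhds hε)).exists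
  exact ⟨κ n, (bregman_le_norm_mul_norm A.one_lt _ _).trans_lt hn⟩

end SGDSetting

end Path

/-! ### Expectations and almost sure convergence -/

section Probability

/-- Tonelli: a sum with finite integral is finite almost everywhere. -/
theorem ae_summable_of_summable_integral {Ω : Type*} [MeasurableSpace Ω] {P : Measure Ω}
    {f : ℕ → Ω → ℝ} (hf : ∀ k, Integrable (f k) P) (h0 : ∀ k ω, 0 ≤ f k ω)
    (h : Summable fun k => ∫ ω, f k ω ∂P) : ∀ᵐ ω ∂P, Summable fun k => f k ω := by
  have hm (k : ℕ) : AEMeasurable (fun ω => ENNReal.ofReal (f k ω)) P :=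
    (hf k).aestronglyMeasurable.aemeasurable.ennreal_ofReal
  have h1 : ∫⁻ ω, ∑' k, ENNReal.ofReal (f k ω) ∂P ≠ ⊤ := by
    rw [lintegral_tsum hm]
    simp_rw [← ofReal_integral_eq_lintegral_ofReal (hf _) (Eventually.of_forall (h0 _))]
    exact h.tsum_ofReal_ne_top
  filter_upwards [ae_lt_top' (AEMeasurable.tsum hm) h1] with ω hω
  have := ENNReal.summable_toReal hω.ne
  simpa only [ENNReal.toReal_ofReal (h0 _ _)] using this

variable {X : Type*} [NormedAddCommGroup X] [NormedSpace ℝ X] {N : ℕ}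
  {Y : Fin N → Type*} [∀ i, NormedAddCommGroup (Y i)] [∀ i, NormedSpace ℝ (Y i)]
  {p : ℝ} {F : ∀ i, X → Y i} {F' : ∀ i, X → X →L[ℝ] Y i} {y : ∀ i, Y i}
  {j : ∀ i, Y i → StrongDual ℝ (Y i)} {S : Set X} {Λ γ : ℝ} {μ : ℕ → ℝ} {C : ℝ} {x₀ xs : X}
  {Ω : Type*} {idx : ℕ → Ω → Fin N} {x : ℕ → Ω → X}

namespace SGDSetting

variable (A : SGDSetting p F F' y j S Λ γ μ C x₀ xs)
  (hx : ∀ ω, IsSGDSequence p F F' y j μ x₀ (fun k => idx k ω) (fun k => x k ω))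
include A hx

/-- The `k`-th iterate is a function of the first `k` random indices. -/
theorem exists_eq_comp_indices (k : ℕ) :
    ∃ G : (Finset.range k → Fin N) → X, ∀ ω, x k ω = G fun l => idx (l + 1) ω := by
  have key : ∀ ω ω', (∀ l < k, idx (l + 1) ω = idx (l + 1) ω') → x k ω = x k ω' := by
    intro ω ω'
    induction k with
    | zero => exact fun _ => (hx ω).1.trans (hx ω').1.symm
    | succ k ih =>
      intro h
      have h1 := A.mem_dualityMap (hx ω) k
      have h2 := A.mem_dualityMap (hx ω') k
      simp only [ih fun l hl => h l (by omega), h k (by omega)] at h1 h2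
      -- The same dual element lies in the duality map of both next iterates, which strict
      -- monotonicity forces to coincide.
      exact A.pconvex.eq_of_dualityMap A.two_le h1 h2 (by simp)
  have : Nonempty X := ⟨x₀⟩
  have hfac : (x k).FactorsThrough fun ω (l : Finset.range k) => idx (l + 1) ω :=
    fun ω ω' h => key ω ω' fun l hl => congrFun h ⟨l, Finset.mem_range.2 hl⟩
  obtain ⟨G, hG⟩ := (Function.factorsThrough_iff _).1 hfac
  exact ⟨G, fun ω => congrFun hG ω⟩

variable [MeasurableSpace Ω] {P : Measure Ω} [IsProbabilityMeasure P]
  (hidx : ∀ k, Measurable (idx (k + 1)))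
include hidx

/-- The iterate `x k` factors through a finite set of index histories, so `H` may be arbitrary. -/
theorem integrable_comp (k : ℕ) (H : X → ℝ) : Integrable (fun ω => H (x k ω)) P := by
  obtain ⟨G, hG⟩ := A.exists_eq_comp_indices hx k
  simp only [hG]
  have hm : Measurable fun ω (l : Finset.range k) => idx (l + 1) ω :=
    measurable_pi_lambda _ fun l => hidx l
  obtain ⟨B, hB⟩ := (Set.finite_range fun a => ‖H (G a)‖).bddAbove
  exact Integrable.of_bound
    ((measurable_of_countable fun a => H (G a)).comp hm).aestronglyMeasurable B
    (Eventually.of_forall fun ω => hB ⟨_, rfl⟩)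

theorem tendsto_integral_comp {H : X → ℝ} {B : ℝ} (hB : ∀ k ω, ‖H (x k ω)‖ ≤ B)
    (h : ∀ᵐ ω ∂P, Tendsto (fun k => H (x k ω)) atTop (𝓝 0)) :
    Tendsto (fun k => ∫ ω, H (x k ω) ∂P) atTop (𝓝 0) := by
  simpa using tendsto_integral_of_dominated_convergence (fun _ => B)
    (fun k => (A.integrable_comp hx hidx k H).aestronglyMeasurable) (integrable_const B)
    (fun k => Eventually.of_forall (hB k)) h

variable (hindep : iIndepFun (fun k => idx (k + 1)) P)
  (hunif : ∀ k, ∀ i : Fin N, P.real {ω | idx (k + 1) ω = i} = 1 / N)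
include hindep hunif

/-- This replaces conditioning on the past: split according to the value of `idx (k + 1)`, which is
independent of the indices `idx 1, …, idx k` that determine `x k`. -/
theorem integral_index_comp (k : ℕ) (H : Fin N → X → ℝ) :
    Integrable (fun ω => H (idx (k + 1) ω) (x k ω)) P ∧
      ∫ ω, H (idx (k + 1) ω) (x k ω) ∂P = 1 / N * ∫ ω, ∑ i, H i (x k ω) ∂P := by
  obtain ⟨G, hG⟩ := A.exists_eq_comp_indices hx k
  have hind := hindep.indepFun_finset (Finset.range k) {k} (by simp) hidx
  set ind : Fin N → Ω → ℝ := fun i => {ω | idx (k + 1) ω = i}.indicator 1 with hinddef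
  have hms (i : Fin N) : MeasurableSet {ω | idx (k + 1) ω = i} :=
    hidx k (measurableSet_singleton i)
  have hindm (i : Fin N) : AEStronglyMeasurable (ind i) P :=
    ((stronglyMeasurable_one).indicator (hms i)).aestronglyMeasurable
  have hi (i : Fin N) : IndepFun (fun ω => H i (x k ω)) (ind i) P := by
    have h1 := hind.comp (φ := fun a => H i (G a))
      (ψ := fun a : ({k} : Finset ℕ) → Fin N => if a ⟨k, by simp⟩ = i then (1 : ℝ) else 0)
      (measurable_of_countable _) (measurable_of_countable _)
    convert h1 using 1
    · funext ω
      simp [hG]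
    · funext ω
      simp [hinddef, indicator_apply]
  have hint (i : Fin N) : Integrable (fun ω => H i (x k ω) * ind i ω) P := by
    refine (A.integrable_comp hx hidx k (H i)).mul_bdd (c := 1) (hindm i)
      (Eventually.of_forall fun ω => ?_)
    by_cases h : idx (k + 1) ω = i <;> simp [hinddef, h]
  have hval (i : Fin N) : ∫ ω, H i (x k ω) * ind i ω ∂P = 1 / N * ∫ ω, H i (x k ω) ∂P := by
    rw [(hi i).integral_fun_mul_eq_mul_integral
      (A.integrable_comp hx hidx k (H i)).aestronglyMeasurable (hindm i),
      integral_indicator_one (hms i), hunif, mul_comm]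
  have hsum : (fun ω => H (idx (k + 1) ω) (x k ω)) = fun ω => ∑ i, H i (x k ω) * ind i ω := by
    funext ω
    simp [hinddef, indicator_apply]
  rw [hsum]
  refine ⟨integrable_finsetSum _ fun i _ => hint i, ?_⟩
  rw [integral_finsetSum _ fun i _ => hint i, integral_finsetSum _ fun i _ =>
    A.integrable_comp hx hidx k (H i), Finset.mul_sum]
  exact Finset.sum_congr rfl fun i _ => hval i

/-- Averaging the one-step decrease over the index gives the total residual with factor `C / N`; the
expected distances telescope and stay nonnegative. -/
theorem ae_summable_residualPow [CompleteSpace X] :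
    ∀ᵐ ω ∂P, Summable fun k => μ (k + 1) * residualPow p F y (x k ω) := by
  have hint (k : ℕ) := A.integrable_comp (P := P) hx hidx k
    fun z => μ (k + 1) * residualPow p F y z
  have h0 (k : ℕ) (ω : Ω) : 0 ≤ μ (k + 1) * residualPow p F y (x k ω) :=
    mul_nonneg (A.step_pos k).le (Finset.sum_nonneg fun i _ => by positivity)
  refine ae_summable_of_summable_integral hint h0 ?_
  obtain ⟨ω₀⟩ := nonempty_of_isProbabilityMeasure P
  have hN : (0 : ℝ) < N := Nat.cast_pos.2 (idx 1 ω₀).pos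
  have hC := A.const_pos
  have hstep (k : ℕ) : ∫ ω, bregman p (x (k + 1) ω) xs ∂P +
      C / N * ∫ ω, μ (k + 1) * residualPow p F y (x k ω) ∂P ≤ ∫ ω, bregman p (x k ω) xs ∂P := by
    have h1 := A.integral_index_comp hx hidx hindep hunif k
      fun i z => C * (μ (k + 1) * ‖F i z - y i‖ ^ p)
    have h2 := integral_mono
      ((A.integrable_comp (P := P) hx hidx (k + 1) fun z => bregman p z xs).add h1.1)
      (A.integrable_comp (P := P) hx hidx k fun z => bregman p z xs)
      fun ω => A.bregman_succ_le (hx ω) k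
    simp only [Pi.add_apply] at h2
    rw [integral_add (A.integrable_comp (P := P) hx hidx (k + 1) fun z => bregman p z xs) h1.1,
      h1.2] at h2
    simp only [← Finset.mul_sum] at h2
    rw [integral_const_mul] at h2
    calc _ = ∫ ω, bregman p (x (k + 1) ω) xs ∂P +
          1 / N * (C * ∫ ω, μ (k + 1) * ∑ i, ‖F i (x k ω) - y i‖ ^ p ∂P) := by
          simp only [residualPow]
          ring
      _ ≤ _ := h2
  refine summable_of_sum_range_le (c := (C / N)⁻¹ * ∫ ω, bregman p (x 0 ω) xs ∂P)
    (fun k => integral_nonneg (h0 k)) fun n => ?_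
  have key : ∫ ω, bregman p (x n ω) xs ∂P + C / N * ∑ k ∈ Finset.range n,
      ∫ ω, μ (k + 1) * residualPow p F y (x k ω) ∂P ≤ ∫ ω, bregman p (x 0 ω) xs ∂P := by
    induction n with
    | zero => simp
    | succ n ih =>
      rw [Finset.sum_range_succ, mul_add]
      linarith [hstep n]
  have hnn : 0 ≤ ∫ ω, bregman p (x n ω) xs ∂P :=
    integral_nonneg fun ω => bregman_nonneg A.one_lt _ _
  rw [inv_mul_eq_div, le_div_iff₀' (by positivity)]
  linarith

/-- The iterates converge almost surely in Bregman distance to the solution. -/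
theorem ae_tendsto_bregman [CompleteSpace X] :
    ∀ᵐ ω ∂P, Tendsto (fun k => bregman p (x k ω) xs) atTop (𝓝 0) := by
  filter_upwards [A.ae_summable_residualPow hx hidx hindep hunif] with ω hω
  exact A.tendsto_of_summable (hx ω) hω

end SGDSetting

end Probability

end

/-! ### Assembling the theorem -/

theorem bregmanBall_mem_nhds {E : Type*} [NormedAddCommGroup E] [NormedSpace ℝ E] {p : ℝ}
    (hs : IsUniformlySmooth E) (hp : 1 < p) (x : E) {ν : ℝ} (hν : 0 < ν) :
    bregmanBall p x ν ∈ 𝓝 x := by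
  have hc : Tendsto (fun z => ‖dualityMapFun p z - dualityMapFun p x‖ * ‖z - x‖) (𝓝 x)
      (𝓝 0) := by
    simpa using (((hs.continuous_dualityMapFun hp).tendsto x).sub_const
      (dualityMapFun p x)).norm.mul (((continuous_id (X := E)).tendsto x).sub_const x).norm
  filter_upwards [hc.eventually (gt_mem_nhds hν)] with z hz
  exact (bregman_le_norm_mul_norm hp z x).trans hz.le

theorem mainTheorem2
    {X : Type*} [NormedAddCommGroup X] [NormedSpace ℝ X] [CompleteSpace X]
    {N : ℕ} {Y : Fin N → Type*} [∀ i, NormedAddCommGroup (Y i)] [∀ i, NormedSpace ℝ (Y i)]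
    [∀ i, CompleteSpace (Y i)]
    {Ω : Type*} [MeasurableSpace Ω] (P : Measure Ω) [IsProbabilityMeasure P]
    -- geometry of `X`
    (p : ℝ) (hp : 2 ≤ p) (hXconv : IsPConvex p X) (hXsmooth : IsUniformlySmooth X)
    -- the operators `F_i` with domains `D_i`, their derivatives on `S`, and the exact data `y`
    (D : Fin N → Set X) (F : ∀ i, X → Y i) (F' : ∀ i, X → X →L[ℝ] Y i) (y : ∀ i, Y i)
    (S : Set X) (hSclosed : IsClosed S) (hSconvex : Convex ℝ S) (hSD : S ⊆ ⋂ i, D i)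
    (hF' : ∀ i, ∀ x ∈ S, HasFDerivWithinAt (F i) (F' i x) (D i) x)
    (L : Fin N → ℝ) (hL : ∀ i, ∀ x ∈ S, ‖F' i x‖ ≤ L i)
    (γ : ℝ) (hγ0 : 0 < γ) (hγ1 : γ < 1)
    (hTCC : ∀ i, ∀ x ∈ S, ∀ x' ∈ S,
      ‖F i x - F i x' - F' i x (x - x')‖ ≤ γ * ‖F i x - F i x'‖)
    (hweak : WeakToWeakContinuousOn F (⋂ i, D i))
    -- the initial guess and the reference solution
    (x₀ xs : X) (hxs : IsMinDistanceSolution p F y S x₀ xs)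
    (ν : ℝ) (hν : 0 < ν) (hball : bregmanBall p xs ν ⊆ S) (hx₀ : x₀ ∈ bregmanBall p xs ν)
    (hker : ∀ x ∈ S, ∀ h : X, (∀ i, F' i xs h = 0) → ∀ i, F' i x h = 0)
    -- the step-sizes
    (μ : ℕ → ℝ) (hμpos : ∀ k, 0 < μ (k + 1))
    (C : ℝ) (hC : 0 < C)
    (hμ : ∀ k, C ≤ 1 - γ - (⨆ i, L i) ^ p.conjExponent *
      (dualSmoothnessConst p X / p.conjExponent) * μ (k + 1) ^ (p.conjExponent - 1))
    (hμsum : Tendsto (fun n => ∑ k ∈ Finset.range n, μ (k + 1)) atTop atTop)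
    -- the indices `i_1, i_2, …`: independent and uniformly distributed
    (idx : ℕ → Ω → Fin N) (hidx : ∀ k, Measurable (idx (k + 1)))
    (hindep : iIndepFun (fun k => idx (k + 1)) P)
    (hunif : ∀ k, ∀ i : Fin N, P.real {ω | idx (k + 1) ω = i} = 1 / N)
    -- the iterates
    (j : ∀ i, Y i → StrongDual ℝ (Y i)) (hj : ∀ i, ∀ v, j i v ∈ dualityMap p v)
    (x : ℕ → Ω → X)
    (hx : ∀ ω, IsSGDSequence p F F' y j μ x₀ (fun k => idx k ω) (fun k => x k ω)) :
    ((∀ k, Integrable (fun ω => bregman p (x k ω) xs) P) ∧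
      Tendsto (fun k => ∫ ω, bregman p (x k ω) xs ∂P) atTop (𝓝 0)) ∧
    (∀ r : ℝ, 1 ≤ r → r ≤ p →
      (∀ k, Integrable (fun ω => ‖x k ω - xs‖ ^ r) P) ∧
      Tendsto (fun k => ∫ ω, ‖x k ω - xs‖ ^ r ∂P) atTop (𝓝 0)) ∧
    ((∀ k, Integrable (fun ω =>
        ‖dualityMapFun p (x k ω) - dualityMapFun p xs‖ ^ p.conjExponent) P) ∧
      Tendsto (fun k => ∫ ω,
        ‖dualityMapFun p (x k ω) - dualityMapFun p xs‖ ^ p.conjExponent ∂P) atTop (𝓝 0)) := by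
  have hp1 : 1 < p := by linarith
  have hp0 : 0 < p := by linarith
  have hpq := Real.HolderConjugate.conjExponent hp1
  have A : SGDSetting p F F' y j S (⨆ i, L i) γ μ C x₀ xs :=
    { two_le := hp
      pconvex := hXconv
      smooth := hXsmooth
      closed := hSclosed
      norm_deriv_le := fun i x hx =>
        (hL i x hx).trans (le_ciSup (Set.finite_range L).bddAbove i)
      lt_one := hγ1
      cone := hTCC
      sol := hxs
      ball := fun z hz => hball
        (show bregman p z xs ≤ ν from le_trans (show _ ≤ bregman p x₀ xs from hz) hx₀)
      mem_nhds := mem_of_superset (bregmanBall_mem_nhds hXsmooth hp1 xs hν) hball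
      ker := hker
      selection := hj
      step_pos := hμpos
      const_pos := hC
      step_le := hμ
      step_sum := hμsum }
  obtain ⟨c, hc, hbreg⟩ := hXconv.exists_le_bregman hp
  have hlim := A.ae_tendsto_bregman hx hidx hindep hunif
  have hle (k : ℕ) (ω : Ω) : bregman p (x k ω) xs ≤ bregman p x₀ xs :=
    (A.bregman_le_and_mem (hx ω) k).1
  have hnorm (k : ℕ) (ω : Ω) : ‖x k ω - xs‖ ≤ (bregman p (x k ω) xs / c) ^ p⁻¹ := by
    rw [Real.le_rpow_inv_iff_of_pos (norm_nonneg _)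
      (div_nonneg (bregman_nonneg hp1 _ _) hc.le) hp0, le_div_iff₀' hc]
    exact hbreg _ _
  -- A bound on `‖x k ω - xs‖` uniform in `k` and `ω`; it supplies the dominating constants for the
  -- norm and duality-map limits.
  set b := (bregman p x₀ xs / c) ^ p⁻¹ with hb
  have hnorm_le (k : ℕ) (ω : Ω) : ‖x k ω - xs‖ ≤ b := by
    refine (hnorm k ω).trans (Real.rpow_le_rpow (div_nonneg (bregman_nonneg hp1 _ _) hc.le) ?_
      (by positivity))
    gcongr
    exact hle k ω
  have hnorm_lim : ∀ᵐ ω ∂P, Tendsto (fun k => ‖x k ω - xs‖) atTop (𝓝 0) := by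
    filter_upwards [hlim] with ω hω
    refine squeeze_zero (fun k => norm_nonneg _) (fun k => hnorm k ω) ?_
    simpa [Real.zero_rpow (inv_ne_zero hp0.ne')] using
      (hω.div_const c).rpow_const (p := p⁻¹) (Or.inr (by positivity))
  refine ⟨⟨fun k => A.integrable_comp hx hidx k fun z => bregman p z xs,
    A.tendsto_integral_comp hx hidx (H := fun z => bregman p z xs) (B := bregman p x₀ xs)
      (fun k ω => ?_) hlim⟩,
    fun r hr _ => ⟨fun k => A.integrable_comp hx hidx k fun z => ‖z - xs‖ ^ r,
      A.tendsto_integral_comp hx hidx (H := fun z => ‖z - xs‖ ^ r) (B := b ^ r)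
        (fun k ω => ?_) ?_⟩,
    fun k => A.integrable_comp hx hidx k
      fun z => ‖dualityMapFun p z - dualityMapFun p xs‖ ^ p.conjExponent,
    A.tendsto_integral_comp hx hidx
      (H := fun z => ‖dualityMapFun p z - dualityMapFun p xs‖ ^ p.conjExponent)
      (B := ((b + ‖xs‖) ^ (p - 1) + ‖dualityMapFun p xs‖) ^ p.conjExponent)
      (fun k ω => ?_) ?_⟩
  · rw [Real.norm_of_nonneg (bregman_nonneg hp1 _ _)]
    exact hle k ω
  · rw [Real.norm_of_nonneg (by positivity)]
    exact Real.rpow_le_rpow (norm_nonneg _) (hnorm_le k ω) (by linarith)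
  · filter_upwards [hnorm_lim] with ω hω
    simpa [Real.zero_rpow (by linarith : r ≠ 0)] using
      hω.rpow_const (p := r) (Or.inr (by linarith))
  · rw [Real.norm_of_nonneg (by positivity)]
    refine Real.rpow_le_rpow (norm_nonneg _) ((norm_sub_le _ _).trans ?_) hpq.symm.nonneg
    gcongr
    rw [← (dualityMapFun_mem hp1 (x k ω)).2]
    refine Real.rpow_le_rpow (norm_nonneg _) ?_ (by linarith)
    have := norm_add_le (x k ω - xs) xs
    rw [sub_add_cancel] at this
    linarith [hnorm_le k ω]
  · filter_upwards [hnorm_lim] with ω hω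
    have h1 : Tendsto (fun k => x k ω) atTop (𝓝 xs) := tendsto_iff_norm_sub_tendsto_zero.2 hω
    have h2 := tendsto_iff_norm_sub_tendsto_zero.1
      (((hXsmooth.continuous_dualityMapFun hp1).tendsto xs).comp h1)
    simpa [Real.zero_rpow hpq.symm.ne_zero] using
      h2.rpow_const (p := p.conjExponent) (Or.inr hpq.symm.nonneg)
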